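/- For a field $K$ and $c \in K$, let $f_c(z) = z^2 + c$, and let $G(f_c,K)$ be the directed graph whose vertices are the points $x \in K$ that are preperiodic for $f_c$ (that is, $f_c^{m+n}(x) = f_c^{n}(x)$ for some integers $m \ge 1$, $n \ge 0$), with an edge from $x$ to $y$ if and only if $f_c(x) = y$. A vertex $v$ of a directed graph in which every vertex has out-degree $1$ is said to have type $1_n$ if walking along the edges from $v$ first reaches a fixed vertex (a vertex with a self-loop) after exactly $n$ steps. Let $G_1$ be the smallest directed graph in which every vertex has out-degree $1$ and in-degree $0$ or $2$ and which contains a vertex $\alpha$ of type $1_3$ and a vertex $\beta$ of type $1_2$ with disjoint orbits. Explicitly, $G_1$ has ten vertices $p, q, \gamma, \gamma', \alpha, \alpha', p', q', \beta, \beta'$ and the edges $$p \to p,\quad q \to p,\quad \gamma \to q,\quad \gamma' \to q,\quad \alpha \to \gamma,\quad \alpha' \to \gamma,\quad p' \to p',\quad q' \to p',\quad \beta \to q',\quad \beta' \to q'.$$ **Theorem.** Let $K$ be a quadratic field (a field extension of $\mathbb{Q}$ of degree $2$) and let $c \in K$. Then $G(f_c,K)$ does not contain a subgraph isomorphic to $G_1$.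 -/

import Mathlib

/-- The quadratic polynomial map `f_c(z) = z ^ 2 + c` on `K`. -/
def quadMap {K : Type*} [Field K] (c : K) (z : K) : K := z ^ 2 + c

/-- `x` is preperiodic for `f` if `f^(m+n)(x) = f^n(x)` for some integers `m ≥ 1` and `n ≥ 0`. -/
def IsPreperiodicPt {S : Type*} (f : S → S) (x : S) : Prop :=
  ∃ m n : ℕ, 1 ≤ m ∧ f^[m + n] x = f^[n] x

/-- The set of (finite) `K`-rational preperiodic points of `f_c`. -/
def PrePer {K : Type*} [Field K] (c : K) : Set K := {x | IsPreperiodicPt (quadMap c) x}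

/-- The directed graph `G(f_c, K)`: its vertices are the `K`-rational preperiodic points of `f_c`
(the fixed point at infinity is left out), with an edge from `x` to `y` if and only if
`f_c(x) = y`. -/
def preperiodicGraph {K : Type*} [Field K] (c : K) : Digraph (PrePer c) where
  Adj x y := quadMap c (x : K) = (y : K)

/-- `H` contains a subgraph isomorphic to `G`. -/
def Digraph.ContainsCopyOf {V W : Type*} (H : Digraph V) (G : Digraph W) : Prop :=
  ∃ φ : W → V, Function.Injective φ ∧ ∀ i j, G.Adj i j → H.Adj (φ i) (φ j)

/-- The unique out-neighbour of each of the ten vertices of the graph `G_1`.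

* vertices `0, …, 5`: the component of `α = 4`, a point of type `1_3`.  Its orbit is
  `4 → 2 → 1 → 0`, the vertex `0` being fixed; `3` is the second preimage of `1`, and `5` the
  second preimage of `2`.
* vertices `6, …, 9`: the component of `β = 8`, a point of type `1_2`.  Its orbit is `8 → 7 → 6`,
  the vertex `6` being fixed; `9` is the second preimage of `7`. -/
def graphG1Next : Fin 10 → Fin 10 := ![0, 0, 1, 1, 2, 2, 6, 6, 7, 7]

/-- The graph `G_1`: the smallest directed graph with all out-degrees `1` and all in-degrees `0`
or `2` that contains a point of type `1_3` and a point of type `1_2` with disjoint orbits. -/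
def graphG1 : Digraph (Fin 10) where
  Adj i j := graphG1Next i = j

/-!
Let `p` and `p'` be the two fixed points of a copy of `G_1`, `γ` a preimage of `-p`, and `α`, `β`
preimages of `γ` and `-p'`. Then `p' = 1 - p` and `γ² = p² - 2p`, `α² = γ - p + p²`,
`β² = p² - 1`. Parametrizing the conic by `x = -γ / p` and scaling `α` and `β` by `1 - x²` turns
this into a point over `K` of the curve of genus five

  `y² = 2(x³ + x² - x + 1)`,  `z² = (x² + 1)(3 - x²)`,  with `x ≠ ±1`.

Each equation by itself defines a curve of genus one with finitely many rational points, all of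
whose affine ones have `x = ±1`.

* The Jacobian of the quartic is isogenous to a curve with full rational `2`-torsion. The pairs
  of forms `d² + a², d² + 4a²` and `P² + q², P² - 3q²` are treated by infinite descent
  (`not_sq_add_sq_and_sq_add_four_sq`, `not_sq_add_sq_and_sq_sub_three_sq`); duplication formulas
  carry the result to `z² = ±(x² + 1)(3 - x²)` (`sq_eq_one_of_quartic_eq_sq`,
  `quartic_twist_ne_sq`).
* The cubic is a model of `X₁(11)`. Let `θ` be a root of `x³ + x² - x + 1`, generating the cubic
  field of discriminant `-44`. Its ring of integers is principal by the Minkowski bound, its units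
  are `±1` times powers of one unit by Dirichlet's theorem, and congruences modulo the square of
  the prime `θ + 1` above `2` show that `2(x - θ)` is a square for every rational point
  (`exists_sq_eq_two_mul_sub_root`). Hence every rational point is the double of another one
  (`exists_half`), and a comparison of heights leaves only `x = ±1`
  (`eq_one_or_neg_one_of_sq_eq_cubic`).

Let now `K` be quadratic. If `x` is not rational, its minimal polynomial is restricted by both
curves: the line through the point `(x, y)` and its conjugate meets the cubic in a third rational
point, which must be one of `(±1, ±2)`, and a parabola through `(1, 2)`, `(x, z)` and the conjugate
of the latter meets the quartic in another rational point `(±1, ±2)`. The resulting one-parameter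
families of polynomials `T² + AT + B` meet only in reducible polynomials (`cubic_families`,
`quartic_families`, `families_disjoint`). If `x` is rational, then `y` or `z` is rational, or the
cubic and the quartic differ by a square factor. Being coprime up to powers of `2` as binary forms,
they are then squares up to sign and powers of `2`, which leads back to
`z² = ±(x² + 1)(3 - x²)` over the rationals (`sq_eq_one_of_quartic_eq_sq_mul_cubic`).
-/

/-! ### Two descents on pairs of quadratic forms -/

theorem exists_four_factors {M N m n : ℤ} (hM : 0 < M) (hN : 0 < N) (hm : 0 < m) (hn : 0 < n)
    (h : M * N = m * n) :
    ∃ a b c d : ℤ, 0 < a ∧ 0 < b ∧ 0 < c ∧ 0 < d ∧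
      M = a * b ∧ N = c * d ∧ m = a * c ∧ n = b * d := by
  lift M to ℕ using hM.le
  lift N to ℕ using hN.le
  lift m to ℕ using hm.le
  lift n to ℕ using hn.le
  norm_cast at *
  obtain ⟨a, b, ⟨c, rfl⟩, ⟨d, rfl⟩, rfl⟩ := exists_dvd_and_dvd_of_dvd_mul (Dvd.intro N h)
  have ha : 0 < a := Nat.pos_of_mul_pos_right hM
  have hb : 0 < b := Nat.pos_of_mul_pos_left hM
  have hc : 0 < c := Nat.pos_of_mul_pos_left hm
  have hd : 0 < d := Nat.pos_of_mul_pos_left hn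
  refine ⟨a, b, c, d, by exact_mod_cast ha, by exact_mod_cast hb, by exact_mod_cast hc,
    by exact_mod_cast hd, by norm_cast, ?_, by norm_cast, by norm_cast⟩
  have : (a * b) * N = (a * b) * (c * d) := by rw [h]; ring
  exact_mod_cast Nat.eq_of_mul_eq_mul_left (Nat.mul_pos ha hb) this

theorem exists_common_quotient {X Y U V : ℤ} (hX : X ≠ 0) (h : IsCoprime X Y)
    (e : X ^ 2 * U = Y ^ 2 * V) : ∃ w, V = w * X ^ 2 ∧ U = w * Y ^ 2 := by
  have hd : X ^ 2 ∣ V := (IsCoprime.pow h).dvd_of_dvd_mul_left (Dvd.intro U e)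
  obtain ⟨w, rfl⟩ := hd
  refine ⟨w, by ring, ?_⟩
  have h2 : X ^ 2 ≠ 0 := pow_ne_zero 2 hX
  apply mul_left_cancel₀ h2
  rw [e]; ring

theorem dvd_of_dvd_mul_sq {w k A B : ℤ} (h : IsCoprime A B) (hA : w ∣ k * A ^ 2)
    (hB : w ∣ k * B ^ 2) : w ∣ k := by
  obtain ⟨u, v, huv⟩ := (IsCoprime.pow h : IsCoprime (A ^ 2) (B ^ 2))
  have : k = u * (k * A ^ 2) + v * (k * B ^ 2) := by linear_combination -k * huv
  rw [this]
  exact dvd_add (Dvd.dvd.mul_left hA u) (Dvd.dvd.mul_left hB v)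

theorem sq_add_sq_ne_three_mul_sq {A B C : ℤ} (h : IsCoprime A B) : A ^ 2 + B ^ 2 ≠ 3 * C ^ 2 := by
  intro e
  have key : ∀ a b c : ZMod 3, a ^ 2 + b ^ 2 = 3 * c ^ 2 → a = 0 ∧ b = 0 := by decide
  have e3 := congrArg (Int.cast : ℤ → ZMod 3) e
  push_cast at e3
  obtain ⟨ha, hb⟩ := key _ _ _ e3
  rw [ZMod.intCast_zmod_eq_zero_iff_dvd] at ha hb
  have := h.isUnit_of_dvd' ha hb
  norm_num [Int.isUnit_iff] at this

theorem sq_emod_eight_of_odd {a : ℤ} (h : a % 2 = 1) : a ^ 2 % 8 = 1 := by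
  have : a % 8 = 1 ∨ a % 8 = 3 ∨ a % 8 = 5 ∨ a % 8 = 7 := by omega
  rcases this with h | h | h | h <;> simp [pow_two, Int.mul_emod, h]

theorem sq_emod_sixteen_of_even {a : ℤ} (h : a % 2 = 0) : a ^ 2 % 16 = 0 ∨ a ^ 2 % 16 = 4 := by
  obtain ⟨k, rfl⟩ : ∃ k, a = 2 * k := ⟨a / 2, by omega⟩
  rcases Int.emod_two_eq_zero_or_one k with hk | hk
  · obtain ⟨j, rfl⟩ : ∃ j, k = 2 * j := ⟨k / 2, by omega⟩
    left; rw [show (2 * (2 * j)) ^ 2 = 16 * j ^ 2 by ring]; omega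
  · right
    have := sq_emod_eight_of_odd hk
    rw [show (2 * k) ^ 2 = 4 * k ^ 2 by ring]; omega

/-- A primitive Pythagorean triple with odd first leg and positive legs, with positive
parameters. -/
theorem exists_pythagorean_parameters {x y z : ℤ} (hy : 0 < y) (hx : x % 2 = 1)
    (hc : IsCoprime x y) (h : x ^ 2 + y ^ 2 = z ^ 2) :
    ∃ m n : ℤ, 0 < m ∧ 0 < n ∧ IsCoprime m n ∧ x = m ^ 2 - n ^ 2 ∧ y = 2 * m * n := by
  have hz : z ≠ 0 := by
    rintro rfl
    nlinarith [sq_nonneg x, sq_pos_of_pos hy]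
  have hp : PythagoreanTriple x y |z| := by
    unfold PythagoreanTriple
    nlinarith [sq_abs z]
  obtain ⟨m, n, hxm, hym, -, hg, -, hm⟩ := hp.coprime_classification'
    (Int.isCoprime_iff_gcd_eq_one.mp hc) hx (abs_pos.mpr hz)
  have hm' : 0 < m := by
    rcases hm.lt_or_eq with h | rfl
    · exact h
    · simp at hym; omega
  refine ⟨m, n, hm', ?_, Int.isCoprime_iff_gcd_eq_one.mpr hg, hxm, hym⟩
  by_contra hn
  nlinarith [mul_nonneg hm (by linarith : 0 ≤ -n)]

/-- Infinite descent: `d² + a²` and `d² + 4a²` are not both squares. The two Pythagorean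
parametrizations of `d` are compared through a common factorization of their products. -/
theorem not_sq_add_sq_and_sq_add_four_sq (k : ℕ) : ∀ d a b c : ℤ, 0 < d → 0 < a → d * a ≤ k →
    IsCoprime d a → d ^ 2 + a ^ 2 = b ^ 2 → d ^ 2 + 4 * a ^ 2 = c ^ 2 → False := by
  induction k with
  | zero => intro d a b c hd ha hk; have := mul_pos hd ha; push_cast at hk; omega
  | succ k ih =>
    intro d a b c hd ha hk hco h1 h2
    push_cast at hk
    rcases Int.emod_two_eq_zero_or_one d with hd2 | hd2
    · -- an even `d` gives the smaller solution `(a, d / 2)`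
      obtain ⟨e, rfl⟩ : ∃ e, d = 2 * e := ⟨d / 2, by omega⟩
      have hc2 : c % 2 = 0 := by
        rcases Int.emod_two_eq_zero_or_one c with h | h
        · exact h
        · have := sq_emod_eight_of_odd h
          rw [← h2, mul_pow] at this
          omega
      obtain ⟨f, rfl⟩ : ∃ f, c = 2 * f := ⟨c / 2, by omega⟩
      have hea : 0 < e * a := mul_pos (by omega) ha
      exact ih a e f b ha (by omega) (by nlinarith)
        (IsCoprime.symm (IsCoprime.of_mul_left_right hco)) (by linarith) (by linarith)
    · have ha2 : a % 2 = 0 := by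
        rcases Int.emod_two_eq_zero_or_one a with h | h
        · exact h
        · have e1 := sq_emod_eight_of_odd h
          have e2 := sq_emod_eight_of_odd hd2
          rcases Int.emod_two_eq_zero_or_one b with h | h
          · have := sq_emod_sixteen_of_even h; omega
          · have := sq_emod_eight_of_odd h; omega
      have hco2 : IsCoprime d (2 * a) := by
        refine IsCoprime.mul_right ?_ hco
        rw [Int.isCoprime_iff_gcd_eq_one]
        exact Int.isCoprime_iff_gcd_eq_one.mp ⟨1, -(d / 2), by omega⟩
      obtain ⟨m, n, hm, hn, hmn, hd1, ha1⟩ := exists_pythagorean_parameters ha hd2 hco h1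
      obtain ⟨M, N, hM, hN, hMN, hd3, ha3⟩ :=
        exists_pythagorean_parameters (by omega) hd2 hco2 (by linarith : d ^ 2 + (2 * a) ^ 2 = c ^ 2)
      have hprod : M * N = 2 * (m * n) := by linarith
      -- the two forms of the new pair agree up to a common factor `w` dividing `3`
      have fin : ∀ x y z t w : ℤ, 0 < x → 0 < y → 0 < t → IsCoprime x y → x * y < d * a →
          x ^ 2 + y ^ 2 = w * z ^ 2 → x ^ 2 + 4 * y ^ 2 = w * t ^ 2 → False := by
        intro x y z t w hx hy ht hxy hlt e1 e2
        have hw : w ∣ 3 := dvd_of_dvd_mul_sq hxy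
          ⟨4 * z ^ 2 - t ^ 2, by linear_combination 4 * e1 - e2⟩
          ⟨t ^ 2 - z ^ 2, by linear_combination e2 - e1⟩
        have hw0 : 0 < w := by
          by_contra hw
          nlinarith [sq_pos_of_pos hx, sq_pos_of_pos hy, sq_pos_of_pos ht,
            mul_nonneg (by linarith : 0 ≤ -w) (sq_nonneg t)]
        have hw3 := Int.le_of_dvd (by norm_num) hw
        interval_cases w
        · exact ih x y z t hx hy (by omega) hxy (by linarith) (by linarith)
        · norm_num at hw
        · exact sq_add_sq_ne_three_mul_sq hxy e1
      have hpos : 0 < m * n := mul_pos hm hn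
      have hda : a ≤ d * a := by nlinarith
      rcases Int.emod_two_eq_zero_or_one M with hM2 | hM2
      · obtain ⟨M', rfl⟩ : ∃ M', M = 2 * M' := ⟨M / 2, by omega⟩
        obtain ⟨x, y, z, t, hx, hy, hz, ht, rfl, rfl, rfl, rfl⟩ :=
          exists_four_factors (by omega) hN hm hn (by linarith : M' * N = m * n)
        obtain ⟨w, e1, e2⟩ := exists_common_quotient (X := z) (Y := y) (by omega)
          (IsCoprime.of_mul_left_right (IsCoprime.of_mul_right_left hmn))
          (by linear_combination hd3 - hd1 : z ^ 2 * (t ^ 2 + x ^ 2) = y ^ 2 * (t ^ 2 + 4 * x ^ 2))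
        refine fin t x y z w ht hx hz
          (IsCoprime.of_mul_left_left (IsCoprime.of_mul_right_right hmn)).symm ?_ e2 e1
        have : t * x ≤ t * x * (y * z) := le_mul_of_one_le_right (mul_pos ht hx).le (mul_pos hy hz)
        linarith
      · have hN2 : N % 2 = 0 := by
          rcases Int.emod_two_eq_zero_or_one N with h | h
          · exact h
          · have := Int.mul_emod M N 2; rw [hM2, h, hprod] at this; omega
        obtain ⟨N', rfl⟩ : ∃ N', N = 2 * N' := ⟨N / 2, by omega⟩
        obtain ⟨x, y, z, t, hx, hy, hz, ht, rfl, rfl, rfl, rfl⟩ :=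
          exists_four_factors hM (by omega) hm hn (by linarith : M * N' = m * n)
        obtain ⟨w, e1, e2⟩ := exists_common_quotient (X := z) (Y := y) (by omega)
          (IsCoprime.of_mul_left_right (IsCoprime.of_mul_right_left hmn))
          (by linear_combination hd3 - hd1 : z ^ 2 * (x ^ 2 + 4 * t ^ 2) = y ^ 2 * (x ^ 2 + t ^ 2))
        refine fin x t z y w hx ht hy
          (IsCoprime.of_mul_left_left (IsCoprime.of_mul_right_right hmn)) ?_ e1 e2
        have : x * t ≤ x * t * (y * z) := le_mul_of_one_le_right (mul_pos hx ht).le (mul_pos hy hz)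
        linarith

/-- Coprime positive factors of three times a square are a square and three times a square. -/
theorem exists_sq_and_three_mul_sq {X Y q : ℤ} (hX : 0 < X) (hY : 0 < Y) (hc : IsCoprime X Y)
    (h : X * Y = 3 * q ^ 2) : ∃ a b : ℤ, X + Y = a ^ 2 + 3 * b ^ 2 ∧ q ^ 2 = (a * b) ^ 2 := by
  have main : ∀ X Y : ℤ, 0 < X → 0 < Y → IsCoprime X Y → X * Y = 3 * q ^ 2 → 3 ∣ X →
      ∃ a b : ℤ, X + Y = a ^ 2 + 3 * b ^ 2 ∧ q ^ 2 = (a * b) ^ 2 := by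
    rintro X Y hX hY hc h ⟨Z, rfl⟩
    have h' : Z * Y = q ^ 2 := by linarith
    have hZ : 0 < Z := by omega
    have hc' : IsCoprime Z Y := IsCoprime.of_mul_left_right hc
    obtain ⟨b, hb⟩ := Int.sq_of_isCoprime hc' h'
    obtain ⟨a, ha⟩ := Int.sq_of_isCoprime hc'.symm ((mul_comm _ _).trans h')
    have hb' : Z = b ^ 2 := by rcases hb with hb | hb; exact hb; nlinarith [sq_nonneg b]
    have ha' : Y = a ^ 2 := by rcases ha with hb | hb; exact hb; nlinarith [sq_nonneg a]
    exact ⟨a, b, by rw [← ha', ← hb']; ring, by rw [← h', ha', hb']; ring⟩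
  rcases (Int.prime_three).dvd_or_dvd (Dvd.intro _ h.symm : (3 : ℤ) ∣ X * Y) with h3 | h3
  · exact main X Y hX hY hc h h3
  · obtain ⟨a, b, h1, h2⟩ := main Y X hY hX hc.symm (by rw [mul_comm]; exact h) h3
    exact ⟨a, b, by rw [add_comm]; exact h1, h2⟩

/-- Infinite descent: `P² + q²` and `P² - 3q²` are not both squares. -/
theorem not_sq_add_sq_and_sq_sub_three_sq (k : ℕ) : ∀ P q s t : ℤ, 0 < P → 0 < q → q ≤ k →
    IsCoprime P q → P ^ 2 + q ^ 2 = s ^ 2 → P ^ 2 - 3 * q ^ 2 = t ^ 2 → False := by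
  induction k with
  | zero => intro P q s t hP hq hk; push_cast at hk; omega
  | succ k ih =>
    intro P q s t hP hq hk hco h1 h2
    push_cast at hk
    -- modulo 16, `q` is even and `P` is odd
    have hpar : P % 2 = 1 ∧ q % 2 = 0 := by
      rcases Int.emod_two_eq_zero_or_one P with hP2 | hP2 <;>
      rcases Int.emod_two_eq_zero_or_one q with hq2 | hq2
      · have := hco.isUnit_of_dvd' (Int.dvd_of_emod_eq_zero hP2) (Int.dvd_of_emod_eq_zero hq2)
        norm_num [Int.isUnit_iff] at this
      · have e1 := sq_emod_eight_of_odd hq2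
        have e2 := sq_emod_sixteen_of_even hP2
        rcases Int.emod_two_eq_zero_or_one s with h | h <;>
        rcases Int.emod_two_eq_zero_or_one t with h' | h' <;>
        · first | have e3 := sq_emod_sixteen_of_even h | have e3 := sq_emod_eight_of_odd h
          first | have e4 := sq_emod_sixteen_of_even h' | have e4 := sq_emod_eight_of_odd h'
          omega
      · exact ⟨hP2, hq2⟩
      · have e1 := sq_emod_eight_of_odd hq2
        have e2 := sq_emod_eight_of_odd hP2
        rcases Int.emod_two_eq_zero_or_one s with h | h
        · have := sq_emod_sixteen_of_even h; omega
        · have := sq_emod_eight_of_odd h; omega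
    obtain ⟨hP2, hq2⟩ := hpar
    obtain ⟨v, u, hv, hu, huv, hP1, hq1⟩ := exists_pythagorean_parameters hq hP2 hco h1
    have ht2 : t % 2 = 1 := by
      have e1 := sq_emod_eight_of_odd hP2
      have e2 := sq_emod_sixteen_of_even hq2
      rcases Int.emod_two_eq_zero_or_one t with h | h
      · have := sq_emod_sixteen_of_even h; omega
      · exact h
    have habs : |t| % 2 = 1 := by rcases abs_choice t with h | h <;> rw [h] <;> omega
    have hlt : |t| < P := by
      rw [← abs_of_pos hP]; apply sq_lt_sq.mp; nlinarith [sq_pos_of_pos hq]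
    obtain ⟨X, hX⟩ : ∃ X, P - |t| = 2 * X := ⟨(P - |t|) / 2, by omega⟩
    obtain ⟨Y, hY⟩ : ∃ Y, P + |t| = 2 * Y := ⟨(P + |t|) / 2, by omega⟩
    have hPXY : P = X + Y := by linarith
    have hXY : X * Y = 3 * (u * v) ^ 2 := by
      have : 4 * (X * Y) = P ^ 2 - |t| ^ 2 := by linear_combination -(2 * Y) * hX - (P - |t|) * hY
      rw [sq_abs, ← h2, hq1] at this
      have h4 : (4 : ℤ) ≠ 0 := by norm_num
      apply mul_left_cancel₀ h4
      linear_combination this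
    have hXYc : IsCoprime X Y := by
      refine isCoprime_of_prime_dvd (by rintro ⟨rfl, rfl⟩; omega) fun r hr hrX hrY => ?_
      have hrw : r ∣ u * v := by
        by_contra hn
        have hc : IsCoprime (r * r) ((u * v) ^ 2) := by
          rw [← sq]; exact IsCoprime.pow ((hr.irreducible.coprime_iff_not_dvd).mpr hn)
        have h3 : r * r ∣ 3 := hc.dvd_of_dvd_mul_right (hXY ▸ mul_dvd_mul hrX hrY)
        exact hr.not_isUnit (Int.prime_three.irreducible.squarefree r h3)
      refine hr.not_isUnit (hco.isUnit_of_dvd' (hPXY ▸ dvd_add hrX hrY) ?_)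
      rw [hq1, show 2 * v * u = 2 * (u * v) by ring]
      exact hrw.mul_left 2
    obtain ⟨a, b, hab1, hab2⟩ := exists_sq_and_three_mul_sq (by omega)
      (by have := abs_nonneg t; omega) hXYc hXY
    have huvpos : 0 < u * v := mul_pos hu hv
    have habne : a * b ≠ 0 := by
      intro h; rw [h] at hab2; nlinarith
    have hab3 : u * v = |a| * |b| := by
      rw [← abs_mul, ← abs_of_pos huvpos]; exact (sq_eq_sq_iff_abs_eq_abs _ _).mp hab2
    have hab4 : v ^ 2 - u ^ 2 = |a| ^ 2 + 3 * |b| ^ 2 := by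
      rw [sq_abs, sq_abs, ← hP1, ← hab1, hPXY]
    obtain ⟨x, y, z, w, hx, hy, hz, hw, hu', hv', ha', hb'⟩ := exists_four_factors hu hv
      (abs_pos.mpr (left_ne_zero_of_mul habne)) (abs_pos.mpr (right_ne_zero_of_mul habne)) hab3
    rw [ha', hb', hu', hv'] at hab4
    rw [hu', hv'] at huv
    have hzy : IsCoprime z y := IsCoprime.of_mul_left_left (IsCoprime.of_mul_right_right huv)
    have hxw : IsCoprime x w :=
      (IsCoprime.of_mul_left_right (IsCoprime.of_mul_right_left huv)).symm
    obtain ⟨l, e1, e2⟩ := exists_common_quotient (by omega) hzy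
      (by linear_combination hab4 : z ^ 2 * (w ^ 2 - x ^ 2) = y ^ 2 * (x ^ 2 + 3 * w ^ 2))
    have hyq : y < q := by
      rw [hq1, hv', hu']
      have : y ≤ y * (z * w * x) := le_mul_of_one_le_right hy.le (mul_pos (mul_pos hz hw) hx)
      linarith
    have hl4 : l ∣ 4 := dvd_of_dvd_mul_sq hxw
      ⟨z ^ 2 - 3 * y ^ 2, by linear_combination e1 - 3 * e2⟩
      ⟨z ^ 2 + y ^ 2, by linear_combination e1 + e2⟩
    have hl0 : 0 < l := by
      by_contra hl
      have := mul_nonneg (by linarith : 0 ≤ -l) (sq_nonneg z)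
      have := sq_pos_of_pos hx
      have := sq_pos_of_pos hw
      linarith
    have hle := Int.le_of_dvd (by norm_num) hl4
    interval_cases l
    · -- both `y` and `z` are even
      have hyz : y % 2 = 0 ∧ z % 2 = 0 := by
        have key : ∀ x y z w : ZMod 4, x ^ 2 + 3 * w ^ 2 = z ^ 2 → w ^ 2 - x ^ 2 = y ^ 2 →
            (2 * x = 0 ∧ 2 * w = 0) ∨ (2 * y = 0 ∧ 2 * z = 0) := by decide
        have f1 := congrArg (Int.cast : ℤ → ZMod 4) e1
        have f2 := congrArg (Int.cast : ℤ → ZMod 4) e2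
        push_cast at f1 f2
        rw [one_mul] at f1 f2
        have cast0 : ∀ j : ℤ, (2 * j : ZMod 4) = 0 → j % 2 = 0 := fun j hj => by
          have : ((2 * j : ℤ) : ZMod 4) = 0 := by push_cast; exact hj
          rw [ZMod.intCast_zmod_eq_zero_iff_dvd] at this
          push_cast at this
          omega
        rcases key _ _ _ _ f1 f2 with ⟨h3, h4⟩ | ⟨h3, h4⟩
        · have := hxw.isUnit_of_dvd' (Int.dvd_of_emod_eq_zero (cast0 _ h3))
            (Int.dvd_of_emod_eq_zero (cast0 _ h4))
          norm_num [Int.isUnit_iff] at this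
        · exact ⟨cast0 _ h3, cast0 _ h4⟩
      obtain ⟨hy2, hz2⟩ := hyz
      have := hzy.isUnit_of_dvd' (Int.dvd_of_emod_eq_zero hz2) (Int.dvd_of_emod_eq_zero hy2)
      norm_num [Int.isUnit_iff] at this
    · rcases Int.emod_two_eq_zero_or_one x with h3 | h3 <;>
      rcases Int.emod_two_eq_zero_or_one w with h4 | h4
      · have := hxw.isUnit_of_dvd' (Int.dvd_of_emod_eq_zero h3) (Int.dvd_of_emod_eq_zero h4)
        norm_num [Int.isUnit_iff] at this
      · have f3 := sq_emod_sixteen_of_even h3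
        have f4 := sq_emod_eight_of_odd h4
        omega
      · have f3 := sq_emod_eight_of_odd h3
        have f4 := sq_emod_sixteen_of_even h4
        omega
      · have f3 := sq_emod_eight_of_odd h3
        have f4 := sq_emod_eight_of_odd h4
        rcases Int.emod_two_eq_zero_or_one z with h5 | h5
        · have := sq_emod_sixteen_of_even h5; omega
        · have := sq_emod_eight_of_odd h5; omega
    · norm_num at hl4
    · exact ih z y w x hz hy (by omega) hzy (by linarith) (by linarith)

/-- Clearing denominators in a rational pair with nonzero entries. -/
theorem exists_coprime_pair_of_rat {a b : ℚ} (ha : a ≠ 0) (hb : b ≠ 0) :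
    ∃ (d e : ℤ) (r : ℚ), r ≠ 0 ∧ 0 < d ∧ 0 < e ∧ IsCoprime d e ∧ a ^ 2 = (r * d) ^ 2 ∧
      b ^ 2 = (r * e) ^ 2 := by
  have hq : a / b ≠ 0 := div_ne_zero ha hb
  refine ⟨|(a / b).num|, (a / b).den, b / (a / b).den, ?_, ?_, ?_, ?_, ?_, ?_⟩
  · exact div_ne_zero hb (by simp)
  · simpa using ⟨ha, hb⟩
  · exact_mod_cast (a / b).pos
  · rw [Int.isCoprime_iff_gcd_eq_one]
    simpa [Int.gcd, Int.natAbs_abs, Nat.Coprime] using (a / b).reduced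
  · have hd : ((a / b).den : ℚ) ≠ 0 := by simp
    have := Rat.mul_den_eq_num (a / b)
    push_cast
    rw [mul_pow, sq_abs, ← this]
    field_simp
  · have hd : ((a / b).den : ℚ) ≠ 0 := by simp
    push_cast
    field_simp

theorem isSquare_int_of_rat {n : ℤ} {r b : ℚ} (hr : r ≠ 0) (h : r ^ 2 * n = b ^ 2) :
    ∃ m : ℤ, n = m ^ 2 := by
  have : IsSquare (n : ℚ) := ⟨b / r, by field_simp; linear_combination h⟩
  obtain ⟨m, hm⟩ := Rat.isSquare_intCast_iff.mp this
  exact ⟨m, by rw [hm, sq]⟩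

theorem eq_zero_of_sq_add_sq_of_sq_add_four_sq {d a b c : ℚ} (h1 : d ^ 2 + a ^ 2 = b ^ 2)
    (h2 : d ^ 2 + 4 * a ^ 2 = c ^ 2) : d = 0 ∨ a = 0 := by
  by_contra! h
  obtain ⟨x, y, r, hr, hx, hy, hxy, e1, e2⟩ := exists_coprime_pair_of_rat h.1 h.2
  obtain ⟨m, hm⟩ := isSquare_int_of_rat (n := x ^ 2 + y ^ 2) (b := b) hr
    (by push_cast; rw [← h1, e1, e2]; ring)
  obtain ⟨l, hl⟩ := isSquare_int_of_rat (n := x ^ 2 + 4 * y ^ 2) (b := c) hr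
    (by push_cast; rw [← h2, e1, e2]; ring)
  exact not_sq_add_sq_and_sq_add_four_sq (x * y).toNat x y m l hx hy (Int.self_le_toNat _) hxy hm hl

theorem eq_zero_of_sq_add_sq_of_sq_sub_three_sq {P q s t : ℚ} (h1 : P ^ 2 + q ^ 2 = s ^ 2)
    (h2 : P ^ 2 - 3 * q ^ 2 = t ^ 2) : P = 0 ∨ q = 0 := by
  by_contra! h
  obtain ⟨x, y, r, hr, hx, hy, hxy, e1, e2⟩ := exists_coprime_pair_of_rat h.1 h.2
  obtain ⟨m, hm⟩ := isSquare_int_of_rat (n := x ^ 2 + y ^ 2) (b := s) hr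
    (by push_cast; rw [← h1, e1, e2]; ring)
  obtain ⟨l, hl⟩ := isSquare_int_of_rat (n := x ^ 2 - 3 * y ^ 2) (b := t) hr
    (by push_cast; rw [← h2, e1, e2]; ring)
  exact not_sq_add_sq_and_sq_sub_three_sq y.toNat x y m l hx hy (Int.self_le_toNat _) hxy hm hl

/-- Doubling on `Y² = X(X+1)(X+4)` at `X = -(x²+1)` makes `X` and its translates squares. -/
theorem sq_eq_one_of_quartic_eq_sq {x z : ℚ} (h : z ^ 2 = (x ^ 2 + 1) * (3 - x ^ 2)) :
    x ^ 2 = 1 := by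
  have hX := eq_zero_of_sq_add_sq_of_sq_add_four_sq (d := (x ^ 2 + 1) ^ 2 - 4) (a := 2 * (x * z))
    (b := (x ^ 2 + 1) ^ 2 - 2 * (x ^ 2 + 1) + 4) (c := (x ^ 2 + 1) ^ 2 - 8 * (x ^ 2 + 1) + 4)
    (by linear_combination 4 * x ^ 2 * h) (by linear_combination 16 * x ^ 2 * h)
  have no3 : x ^ 2 ≠ 3 := fun h3 => by
    have : IsSquare ((3 : ℕ) : ℚ) := ⟨x, by push_cast; rw [← h3, sq]⟩
    rw [Rat.isSquare_natCast_iff] at this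
    exact absurd this (Nat.prime_three.prime.irreducible.not_isSquare)
  rcases hX with h0 | h0
  · have : (x ^ 2 - 1) * (x ^ 2 + 3) = 0 := by linear_combination h0
    rcases mul_eq_zero.mp this with h' | h'
    · linarith
    · nlinarith [sq_nonneg x]
  · exfalso
    have h0' : x * z = 0 := by linarith
    rcases mul_eq_zero.mp h0' with rfl | rfl
    · have : z ^ 2 = 3 := by linarith
      have : IsSquare ((3 : ℕ) : ℚ) := ⟨z, by push_cast; rw [← this, sq]⟩
      rw [Rat.isSquare_natCast_iff] at this
      exact absurd this (Nat.prime_three.prime.irreducible.not_isSquare)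
    · have : (x ^ 2 + 1) * (3 - x ^ 2) = 0 := by linarith
      rcases mul_eq_zero.mp this with h' | h'
      · nlinarith [sq_nonneg x]
      · exact no3 (by linarith)

/-- Doubling on `Y² = X(X+1)(X-3)` at `X = x²`. -/
theorem quartic_twist_ne_sq {x z : ℚ} : z ^ 2 ≠ (x ^ 2 + 1) * (x ^ 2 - 3) := by
  intro h
  have hX := eq_zero_of_sq_add_sq_of_sq_sub_three_sq (P := x ^ 4 + 3) (q := 2 * (x * z))
    (s := x ^ 4 + 2 * x ^ 2 - 3) (t := x ^ 4 - 6 * x ^ 2 - 3)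
    (by linear_combination 4 * x ^ 2 * h) (by linear_combination -12 * x ^ 2 * h)
  have no3 : x ^ 2 ≠ 3 := fun h3 => by
    have : IsSquare ((3 : ℕ) : ℚ) := ⟨x, by push_cast; rw [← h3, sq]⟩
    rw [Rat.isSquare_natCast_iff] at this
    exact absurd this (Nat.prime_three.prime.irreducible.not_isSquare)
  rcases hX with h0 | h0
  · nlinarith [sq_nonneg (x ^ 2)]
  · have h0' : x * z = 0 := by linarith
    rcases mul_eq_zero.mp h0' with rfl | rfl
    · nlinarith [sq_nonneg z]
    · have : (x ^ 2 + 1) * (x ^ 2 - 3) = 0 := by linarith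
      rcases mul_eq_zero.mp this with h' | h'
      · nlinarith [sq_nonneg x]
      · exact no3 (by linarith)

/-! ### The cubic field of discriminant `-44` -/

theorem isUnit_root {R : Type*} [CommRing R] {θ : R} (hθ : θ ^ 3 + θ ^ 2 - θ + 1 = 0) : IsUnit θ :=
  IsUnit.of_mul_eq_one (-θ ^ 2 - θ + 1) (by linear_combination -hθ)

theorem two_eq {R : Type*} [CommRing R] {θ : R} (hθ : θ ^ 3 + θ ^ 2 - θ + 1 = 0) :
    (2 : R) = (θ + 1) ^ 3 * (-θ ^ 2) := by
  linear_combination (θ ^ 2 + 2 * θ + 2) * hθ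

section CubicField

open NumberField Module

variable {K : Type*} [Field K] [NumberField K]

theorem leftMulMatrix_cubic (B : Basis (Fin 3) ℚ K) {t : K} (ht : t ^ 3 + t ^ 2 - t + 1 = 0)
    (hB : ∀ i, B i = t ^ (i : ℕ)) :
    Algebra.leftMulMatrix B t = !![0, 0, -1; 1, 0, 1; 0, 1, -1] := by
  have h0 : t * B 0 = B 1 := by simp [hB]
  have h1 : t * B 1 = B 2 := by simp [hB, sq]
  have h2 : t * B 2 = -B 0 + B 1 - B 2 := by
    simp only [hB]; norm_num; linear_combination ht
  ext i j
  rw [Algebra.leftMulMatrix_eq_repr_mul]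
  fin_cases j
  · simp only [Fin.zero_eta, h0]
    fin_cases i <;> simp
  · simp only [Fin.mk_one, h1]
    fin_cases i <;> simp
  · simp only [Fin.reduceFinMk, h2]
    fin_cases i <;> simp

theorem norm_sub_cubic (B : Basis (Fin 3) ℚ K) {t : K} (ht : t ^ 3 + t ^ 2 - t + 1 = 0)
    (hB : ∀ i, B i = t ^ (i : ℕ)) (x : ℚ) :
    Algebra.norm ℚ (algebraMap ℚ K x - t) = x ^ 3 + x ^ 2 - x + 1 := by
  rw [Algebra.norm_eq_matrix_det B, map_sub, AlgHom.commutes, leftMulMatrix_cubic B ht hB,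
    Matrix.det_fin_three]
  simp [Matrix.algebraMap_matrix_apply]
  ring

theorem discr_cubic (B : Basis (Fin 3) ℚ K) {t : K} (ht : t ^ 3 + t ^ 2 - t + 1 = 0)
    (hB : ∀ i, B i = t ^ (i : ℕ)) : Algebra.discr ℚ B = -44 := by
  have htr : ∀ k, Algebra.trace ℚ K (t ^ k) =
      Matrix.trace ((!![0, 0, -1; 1, 0, 1; 0, 1, -1] : Matrix (Fin 3) (Fin 3) ℚ) ^ k) := by
    intro k
    rw [Algebra.trace_eq_matrix_trace B, map_pow, leftMulMatrix_cubic B ht hB]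
  rw [Algebra.discr_def, Matrix.det_fin_three]
  simp only [Algebra.traceMatrix_apply, Algebra.traceForm_apply, hB, ← pow_add, htr]
  simp [Matrix.trace_fin_three, pow_succ]
  norm_num

/-- The discriminant of a basis of algebraic integers is a square multiple of that of `K`. -/
theorem exists_sq_mul_discr (B : Basis (Fin 3) ℚ K) (hB : ∀ i, IsIntegral ℤ (B i)) :
    ∃ n : ℤ, (n : ℚ) ^ 2 * discr K = Algebra.discr ℚ B := by
  let e := (integralBasis K).indexEquiv B
  let I := (integralBasis K).reindex e
  have hint : IsIntegral ℤ (I.toMatrix B).det := by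
    refine IsIntegral.det fun i j => ?_
    rw [Basis.toMatrix_apply, Basis.repr_reindex_apply]
    obtain ⟨y, hy⟩ : ∃ y : 𝓞 K, algebraMap (𝓞 K) K y = B j := ⟨⟨B j, hB j⟩, rfl⟩
    rw [← hy, integralBasis_repr_apply]
    exact isIntegral_algebraMap
  obtain ⟨n, hn⟩ := IsIntegrallyClosed.isIntegral_iff.mp hint
  refine ⟨n, ?_⟩
  have h1 := Algebra.discr_of_matrix_vecMul I (I.toMatrix B)
  rw [I.toMatrix_map_vecMul B, ← hn] at h1
  rw [h1, coe_discr, Basis.coe_reindex, Algebra.discr_reindex]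
  simp

/-- The power basis relation pins down the discriminant up to a square, which bounds it and
gives its sign. -/
theorem nrComplexPlaces_and_abs_discr (B : Basis (Fin 3) ℚ K) {t : K}
    (ht : t ^ 3 + t ^ 2 - t + 1 = 0) (hB : ∀ i, B i = t ^ (i : ℕ)) :
    InfinitePlace.nrComplexPlaces K = 1 ∧ InfinitePlace.nrRealPlaces K = 1 ∧ |discr K| ≤ 44 := by
  have hint : IsIntegral ℤ t := by
    refine ⟨Polynomial.X ^ 3 + Polynomial.X ^ 2 - Polynomial.X + 1, by monicity!, ?_⟩
    simpa using ht
  obtain ⟨n, hn⟩ := exists_sq_mul_discr B (fun i => by rw [hB]; exact hint.pow _)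
  rw [discr_cubic B ht hB] at hn
  have hn' : n ^ 2 * discr K = -44 := by exact_mod_cast hn
  have hn0 : n ≠ 0 := by rintro rfl; norm_num at hn'
  have hn1 : 1 ≤ n ^ 2 := by have := pow_pos (abs_pos.mpr hn0) 2; rw [sq_abs] at this; omega
  have hneg : discr K < 0 := by nlinarith
  have hsign := sign_discr K
  rw [Int.sign_eq_neg_one_of_neg hneg] at hsign
  have hrank := InfinitePlace.card_add_two_mul_card_eq_rank K
  rw [Module.finrank_eq_card_basis B, Fintype.card_fin] at hrank
  have hr2 : InfinitePlace.nrComplexPlaces K = 1 := by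
    have : InfinitePlace.nrComplexPlaces K ≠ 0 := fun h => by rw [h] at hsign; norm_num at hsign
    omega
  refine ⟨hr2, by omega, ?_⟩
  rw [abs_of_neg hneg]
  nlinarith

theorem isPrincipalIdealRing_cubic (B : Basis (Fin 3) ℚ K) {t : K}
    (ht : t ^ 3 + t ^ 2 - t + 1 = 0) (hB : ∀ i, B i = t ^ (i : ℕ)) :
    IsPrincipalIdealRing (𝓞 K) := by
  obtain ⟨h1, -, h2⟩ := nrComplexPlaces_and_abs_discr B ht hB
  apply RingOfIntegers.isPrincipalIdealRing_of_abs_discr_lt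
  rw [h1, Module.finrank_eq_card_basis B, Fintype.card_fin]
  have h3 : ((|discr K| : ℤ) : ℝ) ≤ 44 := by exact_mod_cast h2
  refine h3.trans_lt ?_
  have := Real.pi_gt_d2
  norm_num [Nat.factorial]
  nlinarith

theorem exists_fundamental_unit_cubic (B : Basis (Fin 3) ℚ K) {t : K}
    (ht : t ^ 3 + t ^ 2 - t + 1 = 0) (hB : ∀ i, B i = t ^ (i : ℕ)) :
    ∃ η : (𝓞 K)ˣ, ∀ u : (𝓞 K)ˣ, ∃ e : ℤ, u = η ^ e ∨ u = -η ^ e := by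
  obtain ⟨h1, h2, -⟩ := nrComplexPlaces_and_abs_discr B ht hB
  have hrank : Units.rank K = 1 := by
    rw [Units.rank, InfinitePlace.card_eq_nrRealPlaces_add_nrComplexPlaces, h1, h2]
  have hu : Unique (Fin (Units.rank K)) := by rw [hrank]; infer_instance
  refine ⟨Units.fundSystem K default, fun u => ?_⟩
  obtain ⟨⟨ζ, e⟩, he, -⟩ := Units.exist_unique_eq_mul_prod K u
  rw [Fintype.prod_unique] at he
  refine ⟨e default, ?_⟩
  rcases Units.torsion_eq_one_or_neg_one_of_odd_finrank
    (by rw [Module.finrank_eq_card_basis B, Fintype.card_fin]; decide) ζ with h | h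
  · left; simpa [h] using he
  · right; simpa [h] using he

section Integers

variable {θ : 𝓞 K}

theorem natAbs_norm_root_add_one (h3 : finrank ℚ K = 3) (hθ : θ ^ 3 + θ ^ 2 - θ + 1 = 0) :
    (Algebra.norm ℤ (θ + 1)).natAbs = 2 := by
  have h2 : (algebraMap ℤ (𝓞 K) 2) = (θ + 1) ^ 3 * (-θ ^ 2) := by rw [← two_eq hθ, map_ofNat]
  have hn := congrArg (Algebra.norm ℤ) h2
  rw [Algebra.norm_algebraMap, RingOfIntegers.rank, h3, map_mul, map_pow] at hn
  have hnu : (Algebra.norm ℤ (-θ ^ 2 : 𝓞 K)).natAbs = 1 :=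
    Int.isUnit_iff_natAbs_eq.mp (((isUnit_root hθ).pow 2).neg.map (Algebra.norm ℤ))
  have := congrArg Int.natAbs hn
  rw [Int.natAbs_mul, hnu, mul_one, Int.natAbs_pow, Int.natAbs_pow] at this
  exact (Nat.pow_left_injective (by norm_num : 3 ≠ 0) this).symm

theorem not_isUnit_root_add_one (h3 : finrank ℚ K = 3) (hθ : θ ^ 3 + θ ^ 2 - θ + 1 = 0) :
    ¬ IsUnit (θ + 1) := fun h => by
  have := Int.isUnit_iff_natAbs_eq.mp (h.map (Algebra.norm ℤ))
  rw [natAbs_norm_root_add_one h3 hθ] at this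
  norm_num at this

/-- The prime `θ + 1` above `2` has residue field of two elements. -/
theorem dvd_or_dvd_sub_one (h3 : finrank ℚ K = 3) (hθ : θ ^ 3 + θ ^ 2 - θ + 1 = 0) (β : 𝓞 K) :
    θ + 1 ∣ β ∨ θ + 1 ∣ β - 1 := by
  have hcard : Nat.card (𝓞 K ⧸ Ideal.span {θ + 1}) = 2 := by
    rw [← natAbs_norm_root_add_one h3 hθ, ← Ideal.absNorm_span_singleton, Ideal.absNorm_apply,
      Submodule.cardQuot_apply]
  have hne : (0 : 𝓞 K ⧸ Ideal.span {θ + 1}) ≠ 1 := by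
    intro h
    have := subsingleton_of_zero_eq_one h
    rw [Nat.card_unique] at hcard
    norm_num at hcard
  obtain ⟨y, -, hy⟩ := (Nat.card_eq_two_iff' (0 : 𝓞 K ⧸ Ideal.span {θ + 1})).mp hcard
  rw [← Ideal.mem_span_singleton, ← Ideal.mem_span_singleton, ← Ideal.Quotient.eq_zero_iff_mem,
    ← Ideal.Quotient.eq_zero_iff_mem, map_sub, map_one, sub_eq_zero]
  by_cases h : Ideal.Quotient.mk (Ideal.span {θ + 1}) β = 0
  · exact Or.inl h
  · exact Or.inr ((hy _ h).trans (hy 1 hne.symm).symm)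

theorem sq_dvd_sq_sub_one (h3 : finrank ℚ K = 3) (hθ : θ ^ 3 + θ ^ 2 - θ + 1 = 0) {β : 𝓞 K}
    (hβ : ¬ θ + 1 ∣ β) : (θ + 1) ^ 2 ∣ β ^ 2 - 1 := by
  obtain ⟨γ, hγ⟩ := (dvd_or_dvd_sub_one h3 hθ β).resolve_left hβ
  refine ⟨γ ^ 2 - γ * (θ + 1) ^ 2 * θ ^ 2, ?_⟩
  linear_combination (β + 1 + (θ + 1) * γ) * hγ + (θ + 1) * γ * two_eq hθ

/-- `θ` is not congruent to `±` a square modulo `(θ + 1)²`, since a square prime to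
`θ + 1` is congruent to both `1` and `-1`. -/
theorem root_sub_sq_unit (h3 : finrank ℚ K = 3) (hθ : θ ^ 3 + θ ^ 2 - θ + 1 = 0) {w : 𝓞 K}
    (hw : IsUnit w) : ¬ (θ + 1) ^ 2 ∣ θ - w ^ 2 ∧ ¬ (θ + 1) ^ 2 ∣ θ + w ^ 2 := by
  have hπ := not_isUnit_root_add_one h3 hθ
  have h1 := sq_dvd_sq_sub_one h3 hθ (fun h => hπ (isUnit_of_dvd_unit h hw))
  have hno : ¬ (θ + 1) ^ 2 ∣ θ + 1 := by
    rintro ⟨c, hc⟩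
    have h0 : θ + 1 ≠ 0 := by
      intro h
      have := natAbs_norm_root_add_one h3 hθ
      rw [h, Algebra.norm_zero] at this
      norm_num at this
    refine hπ (IsUnit.of_mul_eq_one c (mul_left_cancel₀ h0 ?_))
    linear_combination -hc
  have h2 : (θ + 1) ^ 2 ∣ 2 := ⟨(θ + 1) * (-θ ^ 2), by rw [two_eq hθ]; ring⟩
  constructor <;> intro h <;> apply hno
  · have := dvd_add (dvd_add h h1) h2
    ring_nf at this ⊢; exact this
  · have := dvd_sub h h1
    ring_nf at this ⊢; exact this

/-- A unit congruent to `1` modulo `(θ + 1)²` is a square up to sign: the class of `θ` generates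
the units modulo `±` squares. -/
theorem unit_eq_sq_or_neg_sq (B : Basis (Fin 3) ℚ K) (hB : ∀ i, B i = (θ : K) ^ (i : ℕ))
    (hθ : θ ^ 3 + θ ^ 2 - θ + 1 = 0) {u : 𝓞 K} (hu : IsUnit u) (h1 : (θ + 1) ^ 2 ∣ u - 1) :
    ∃ v, u = v ^ 2 ∨ u = -v ^ 2 := by
  have h3 : finrank ℚ K = 3 := by rw [Module.finrank_eq_card_basis B, Fintype.card_fin]
  have hθK : (θ : K) ^ 3 + (θ : K) ^ 2 - θ + 1 = 0 := by
    have := congrArg (algebraMap (𝓞 K) K) hθ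
    simpa using this
  obtain ⟨η, hη⟩ := exists_fundamental_unit_cubic B hθK hB
  obtain ⟨e, he⟩ := hη hu.unit
  obtain ⟨k, hk⟩ := hη (isUnit_root hθ).unit
  have hval : ∀ (x : 𝓞 K) (hx : IsUnit x) (w : (𝓞 K)ˣ), hx.unit = w ∨ hx.unit = -w →
      x = w ∨ x = -w := by
    rintro x hx w (h | h)
    · left; rw [← h, IsUnit.unit_spec]
    · right; rw [← hx.unit_spec, h]; simp
  rcases Int.even_or_odd' e with ⟨j, rfl | rfl⟩
  · refine ⟨(η ^ j : (𝓞 K)ˣ), ?_⟩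
    have := hval u hu _ he
    rwa [mul_comm 2 j, zpow_mul, zpow_ofNat, Units.val_pow_eq_pow_val] at this
  · exfalso
    rcases Int.even_or_odd' k with ⟨l, rfl | rfl⟩
    · have h := hval θ _ _ hk
      rw [mul_comm 2 l, zpow_mul, zpow_ofNat, Units.val_pow_eq_pow_val] at h
      obtain ⟨hn1, hn2⟩ := root_sub_sq_unit h3 hθ (η ^ l).isUnit
      rcases h with h | h
      · apply hn1; rw [h]; simp
      · apply hn2; rw [h]; simp
    · have hu' := hval u hu _ he
      have h := hval θ _ _ hk
      have hrel : (η ^ (2 * l + 1) : (𝓞 K)ˣ) = η ^ (2 * j + 1) * (η ^ (l - j)) ^ 2 := by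
        rw [← zpow_natCast, ← zpow_mul, ← zpow_add]; congr 1; push_cast; ring
      have hrel' := congrArg Units.val hrel
      rw [Units.val_mul, Units.val_pow_eq_pow_val] at hrel'
      obtain ⟨hn1, hn2⟩ := root_sub_sq_unit h3 hθ (η ^ (l - j)).isUnit
      obtain ⟨c, hc⟩ := h1
      set W := ((η ^ (l - j) : (𝓞 K)ˣ) : 𝓞 K)
      set E := ((η ^ (2 * j + 1) : (𝓞 K)ˣ) : 𝓞 K)
      have : θ = u * W ^ 2 ∨ θ = -(u * W ^ 2) := by
        rw [hrel'] at h
        rcases hu' with rfl | rfl <;> rcases h with h | h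
        · exact Or.inl h
        · exact Or.inr h
        · right; rw [h]; ring
        · left; rw [h]; ring
      rcases this with h | h
      · exact hn1 ⟨c * W ^ 2, by linear_combination h + W ^ 2 * hc⟩
      · exact hn2 ⟨-c * W ^ 2, by linear_combination h - W ^ 2 * hc⟩

end Integers

end CubicField

/-! ### Square values of `2(x³ + x² - x + 1)` and squares in the cubic field -/

/-- In a coprime solution of `2q(p³ + p²q - pq² + q³) = w²` the factor `2q` or `q` is a square. -/
theorem cubic_form_cases {p q w : ℤ} (hpq : IsCoprime p q) (hq : 0 < q)
    (h : 2 * q * (p ^ 3 + p ^ 2 * q - p * q ^ 2 + q ^ 3) = w ^ 2) :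
    ∃ r m : ℤ, p % 2 = 1 ∧ m % 2 = 1 ∧
      ((q = 2 * r ^ 2 ∧ p ^ 3 + p ^ 2 * q - p * q ^ 2 + q ^ 3 = m ^ 2) ∨
       (q = r ^ 2 ∧ q % 2 = 1 ∧ p ^ 3 + p ^ 2 * q - p * q ^ 2 + q ^ 3 = 2 * m ^ 2)) := by
  have hqF : IsCoprime q (p ^ 3 + p ^ 2 * q - p * q ^ 2 + q ^ 3) := by
    have h1 : IsCoprime q (p ^ 3) := hpq.symm.pow_right
    have h2 := (IsCoprime.add_mul_left_right_iff (z := p ^ 2 - p * q + q ^ 2)).mpr h1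
    rwa [show p ^ 3 + q * (p ^ 2 - p * q + q ^ 2) = p ^ 3 + p ^ 2 * q - p * q ^ 2 + q ^ 3 by ring]
      at h2
  set F := p ^ 3 + p ^ 2 * q - p * q ^ 2 + q ^ 3 with hF
  have hF0 : 0 ≤ F := by
    by_contra hneg
    nlinarith [sq_nonneg w, mul_pos hq (by linarith : 0 < -F)]
  have hw2 : w % 2 = 0 := by
    rcases Int.emod_two_eq_zero_or_one w with h2 | h2
    · exact h2
    · have := sq_emod_eight_of_odd h2
      rw [← h, mul_assoc] at this
      omega
  obtain ⟨v, rfl⟩ : ∃ v, w = 2 * v := ⟨w / 2, by omega⟩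
  have pos_sq : ∀ a b : ℤ, 0 ≤ a → (a = b ^ 2 ∨ a = -b ^ 2) → a = b ^ 2 := by
    rintro a b ha (rfl | rfl)
    · rfl
    · nlinarith [sq_nonneg b]
  have odd_cube : ∀ a : ℤ, a % 2 = 1 → (a ^ 3) % 2 = 1 := fun a ha => by
    rw [← Int.odd_iff] at *; exact ha.pow
  rcases Int.emod_two_eq_zero_or_one q with hq2 | hq2
  · obtain ⟨c, rfl⟩ : ∃ c, q = 2 * c := ⟨q / 2, by omega⟩
    have hc : IsCoprime c F := IsCoprime.of_mul_left_right hqF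
    have he : c * F = v ^ 2 := by linarith
    obtain ⟨r, hr⟩ := Int.sq_of_isCoprime hc he
    obtain ⟨m, hm⟩ := Int.sq_of_isCoprime hc.symm ((mul_comm _ _).trans he)
    have hr' := pos_sq _ _ (by omega) hr
    have hm' := pos_sq _ _ hF0 hm
    have hp2 : p % 2 = 1 := by
      rcases Int.emod_two_eq_zero_or_one p with h2 | h2
      · have := hpq.isUnit_of_dvd' (Int.dvd_of_emod_eq_zero h2) (Dvd.intro c rfl)
        norm_num [Int.isUnit_iff] at this
      · exact h2
    refine ⟨r, m, hp2, ?_, Or.inl ⟨by rw [hr'], hm'⟩⟩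
    have hF2 : F % 2 = 1 := by
      have : F = p ^ 3 + 2 * (p ^ 2 * c - 2 * p * c ^ 2 + 4 * c ^ 3) := by rw [hF]; ring
      have := odd_cube p hp2
      omega
    rcases Int.emod_two_eq_zero_or_one m with h2 | h2
    · have := sq_emod_sixteen_of_even h2; omega
    · exact h2
  · have hc : IsCoprime q (2 * F) := by
      refine IsCoprime.mul_right ⟨1, -(q / 2), by omega⟩ hqF
    have he : q * (2 * F) = (2 * v) ^ 2 := by linarith
    obtain ⟨r, hr⟩ := Int.sq_of_isCoprime hc he
    obtain ⟨m, hm⟩ := Int.sq_of_isCoprime hc.symm ((mul_comm _ _).trans he)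
    have hr' := pos_sq _ _ hq.le hr
    have hm' := pos_sq _ _ (by linarith) hm
    have hm2 : m % 2 = 0 := by
      rcases Int.emod_two_eq_zero_or_one m with h2 | h2
      · exact h2
      · have := sq_emod_eight_of_odd h2; omega
    obtain ⟨n, rfl⟩ : ∃ n, m = 2 * n := ⟨m / 2, by omega⟩
    have hFn : F = 2 * n ^ 2 := by linarith
    have hp2 : p % 2 = 1 := by
      rcases Int.emod_two_eq_zero_or_one p with h2 | h2
      · obtain ⟨c, rfl⟩ : ∃ c, p = 2 * c := ⟨p / 2, by omega⟩
        have : F = q ^ 3 + 2 * (4 * c ^ 3 + 2 * c ^ 2 * q - c * q ^ 2) := by rw [hF]; ring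
        have := odd_cube q hq2
        omega
      · exact h2
    refine ⟨r, n, hp2, ?_, Or.inr ⟨hr', hq2, hFn⟩⟩
    have hFm : F % 8 = (2 * q) % 8 := by
      have e1 := sq_emod_eight_of_odd hp2
      have e2 := sq_emod_eight_of_odd hq2
      obtain ⟨i, hi⟩ : ∃ i, p ^ 2 = 8 * i + 1 := ⟨p ^ 2 / 8, by omega⟩
      obtain ⟨j, hj⟩ : ∃ j, q ^ 2 = 8 * j + 1 := ⟨q ^ 2 / 8, by omega⟩
      have : F = 2 * q + 8 * (i * (p + q) - j * (p - q)) := by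
        rw [hF]; linear_combination (p + q) * hi - (p - q) * hj
      omega
    rcases Int.emod_two_eq_zero_or_one n with h2 | h2
    · have := sq_emod_sixteen_of_even h2; omega
    · exact h2

/-- The double root `4` of `x³ + x² - x + 1` modulo `11` is not the reduction of a point: there the
cubic form would have `11`-adic valuation exactly one. -/
theorem isCoprime_eleven {p q e m : ℤ} (hpq : IsCoprime p q) (he : ¬ (11 : ℤ) ∣ e)
    (h : p ^ 3 + p ^ 2 * q - p * q ^ 2 + q ^ 3 = e * m ^ 2) : IsCoprime (3 * p - q) 11 := by
  have h11 : Prime (11 : ℤ) := Int.prime_iff_natAbs_prime.mpr (by norm_num)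
  rw [isCoprime_comm, h11.irreducible.coprime_iff_not_dvd]
  rintro ⟨j, hj⟩
  obtain rfl : q = 3 * p - 11 * j := by linarith
  have hm : (11 : ℤ) ∣ m := by
    have : (11 : ℤ) ∣ e * m ^ 2 :=
      ⟨2 * p ^ 3 - 22 * p ^ 2 * j + 88 * p * j ^ 2 - 121 * j ^ 3, by rw [← h]; ring⟩
    exact h11.dvd_of_dvd_pow ((h11.dvd_or_dvd this).resolve_left he)
  obtain ⟨n, rfl⟩ := hm
  have h2 : (11 : ℤ) ∣ 2 * p ^ 3 := ⟨e * n ^ 2 + 2 * p ^ 2 * j - 8 * p * j ^ 2 + 11 * j ^ 3, by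
    linarith⟩
  have hp : (11 : ℤ) ∣ p :=
    h11.dvd_of_dvd_pow ((h11.dvd_or_dvd h2).resolve_left (by norm_num))
  exact h11.not_isUnit (hpq.isUnit_of_dvd' hp (dvd_sub (hp.mul_left 3) (Dvd.intro j rfl)))

section CubicField

open NumberField Module

variable {K : Type*} [Field K] [NumberField K] {θ : 𝓞 K}

theorem isUnit_of_dvd_of_isCoprime {R : Type*} [CommRing R] {a b : ℤ} (hab : IsCoprime a b) {c : R}
    (ha : c ∣ a) (hb : c ∣ b) : IsUnit c :=
  (hab.map (Int.castRingHom R)).isUnit_of_dvd' ha hb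

/-- The derivative of the cubic at `θ` is `(θ + 1)(3θ - 1)`; a prime common to `p - θq` and the
second factor lies above `2` or `11`. -/
theorem false_of_prime_dvd {R : Type*} [CommRing R] {θ : R} (hθ : θ ^ 3 + θ ^ 2 - θ + 1 = 0)
    {p q : ℤ} (hpq : IsCoprime p q) (h11 : IsCoprime (3 * p - q) 11) {ϖ : R} (hϖ : Prime ϖ)
    (h2 : ¬ ϖ ∣ 2) (h : ϖ ∣ p - θ * q) (h' : ϖ ∣ (3 * θ - 1) * (q : R) ^ 2) : False := by
  rcases hϖ.dvd_or_dvd h' with h1 | h1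
  · have h22 : ϖ ∣ 2 * 11 := by
      have : (2 * 11 : R) = (3 * θ - 1) * (-(9 * θ ^ 2 + 12 * θ - 5)) := by
        linear_combination 27 * hθ
      rw [this]; exact h1.mul_right _
    have h11' := (hϖ.dvd_or_dvd h22).resolve_left h2
    have h3 : ϖ ∣ ((3 * p - q : ℤ) : R) := by
      have : ((3 * p - q : ℤ) : R) = 3 * (p - θ * q) + (3 * θ - 1) * q := by push_cast; ring
      rw [this]; exact dvd_add (h.mul_left _) (h1.mul_right _)
    exact hϖ.not_isUnit (isUnit_of_dvd_of_isCoprime h11 h3 (by exact_mod_cast h11'))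
  · have hq := hϖ.dvd_of_dvd_pow h1
    refine hϖ.not_isUnit (isUnit_of_dvd_of_isCoprime hpq ?_ hq)
    have : (p : R) = (p - θ * q) + θ * q := by ring
    rw [this]; exact dvd_add h (hq.mul_left _)

theorem not_dvd_two_of_dvd_odd {R : Type*} [CommRing R] {m : ℤ} (hm : m % 2 = 1) {ϖ : R}
    (hϖ : ¬ IsUnit ϖ) (h : ϖ ∣ m) : ¬ ϖ ∣ 2 := fun h2 =>
  hϖ (isUnit_of_dvd_of_isCoprime (a := m) (b := 2) ⟨1, -(m / 2), by omega⟩ h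
    (by exact_mod_cast h2))

/-- If `uβ²` is congruent to `1` modulo `(θ + 1)²`, the unit `u` can be absorbed in the square. -/
theorem eq_sq_or_neg_sq_of_associated (B : Basis (Fin 3) ℚ K) (hB : ∀ i, B i = (θ : K) ^ (i : ℕ))
    (hθ : θ ^ 3 + θ ^ 2 - θ + 1 = 0) {β δ : 𝓞 K} (h : Associated (β ^ 2) δ)
    (hδ : (θ + 1) ^ 2 ∣ δ - 1) : ∃ γ, δ = γ ^ 2 ∨ δ = -γ ^ 2 := by
  have h3 : finrank ℚ K = 3 := by rw [Module.finrank_eq_card_basis B, Fintype.card_fin]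
  obtain ⟨u, rfl⟩ := h
  have hβ : ¬ θ + 1 ∣ β := fun hd => by
    refine not_isUnit_root_add_one h3 hθ (isUnit_of_dvd_one ?_)
    have h1 : θ + 1 ∣ β ^ 2 * u := (dvd_pow hd two_ne_zero).mul_right _
    have h2 := (dvd_pow_self (θ + 1) two_ne_zero).trans hδ
    simpa using dvd_sub h1 h2
  have h1 := sq_dvd_sq_sub_one h3 hθ hβ
  have h2 : (θ + 1) ^ 2 ∣ (u : 𝓞 K) - 1 := by
    have := dvd_sub hδ (h1.mul_left (u : 𝓞 K))
    ring_nf at this ⊢; exact this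
  obtain ⟨v, hv | hv⟩ := unit_eq_sq_or_neg_sq B hB hθ u.isUnit h2
  · exact ⟨β * v, Or.inl (by rw [hv]; ring)⟩
  · exact ⟨β * v, Or.inr (by rw [hv]; ring)⟩

/-- The case `q = 2r²` of `cubic_form_cases` in the cubic field. -/
theorem sub_root_eq_sq (B : Basis (Fin 3) ℚ K) (hB : ∀ i, B i = (θ : K) ^ (i : ℕ))
    (hθ : θ ^ 3 + θ ^ 2 - θ + 1 = 0) [IsPrincipalIdealRing (𝓞 K)] {p q m : ℤ}
    (hpq : IsCoprime p q) (hp : p % 2 = 1) (hq : q % 2 = 0) (hm : m % 2 = 1)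
    (h : p ^ 3 + p ^ 2 * q - p * q ^ 2 + q ^ 3 = m ^ 2) :
    ∃ γ : 𝓞 K, p - θ * q = γ ^ 2 ∨ p - θ * q = -γ ^ 2 := by
  have hcast : (p : 𝓞 K) ^ 3 + p ^ 2 * q - p * q ^ 2 + q ^ 3 = m ^ 2 := by exact_mod_cast h
  have h11 := isCoprime_eleven (e := 1) hpq (by norm_num) (by rw [h, one_mul])
  have hprod : (p - θ * q) * (p ^ 2 + (1 + θ) * p * q + (θ ^ 2 + θ - 1) * q ^ 2) =
      (m : 𝓞 K) ^ 2 := by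
    linear_combination hcast - (q : 𝓞 K) ^ 3 * hθ
  have hm0 : (m : 𝓞 K) ≠ 0 := by
    have : m ≠ 0 := by rintro rfl; omega
    exact_mod_cast this
  have hco : IsCoprime (p - θ * q) (p ^ 2 + (1 + θ) * p * q + (θ ^ 2 + θ - 1) * (q : 𝓞 K) ^ 2) := by
    refine isCoprime_of_prime_dvd (fun h0 => ?_) fun ϖ hϖ hd hd' => ?_
    · rw [h0.1, zero_mul] at hprod
      exact hm0 (pow_eq_zero_iff two_ne_zero |>.mp hprod.symm)
    · have hϖm : ϖ ∣ m := hϖ.dvd_of_dvd_pow (hprod ▸ hd.mul_right _)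
      have h2 := not_dvd_two_of_dvd_odd hm hϖ.not_isUnit hϖm
      have hd3 : ϖ ∣ (θ + 1) * ((3 * θ - 1) * (q : 𝓞 K) ^ 2) := by
        have : (θ + 1) * ((3 * θ - 1) * (q : 𝓞 K) ^ 2) =
            (p ^ 2 + (1 + θ) * p * q + (θ ^ 2 + θ - 1) * (q : 𝓞 K) ^ 2) -
              (p - θ * q) * (p - θ * q + (3 * θ + 1) * q) := by ring
        rw [this]; exact dvd_sub hd' (hd.mul_right _)
      rcases hϖ.dvd_or_dvd hd3 with h1 | h1
      · exact h2 (by rw [two_eq hθ]; exact (dvd_pow h1 three_ne_zero).mul_right _)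
      · exact false_of_prime_dvd hθ hpq h11 hϖ h2 hd h1
  obtain ⟨β, hβ⟩ := exists_associated_pow_of_mul_eq_pow' hco hprod
  refine eq_sq_or_neg_sq_of_associated B hB hθ hβ ?_
  obtain ⟨i, rfl⟩ : ∃ i, p = 2 * i + 1 := ⟨p / 2, by omega⟩
  obtain ⟨j, rfl⟩ : ∃ j, q = 2 * j := ⟨q / 2, by omega⟩
  refine ⟨(θ + 1) * (-θ ^ 2) * (i - θ * j), ?_⟩
  push_cast
  linear_combination (i - θ * j : 𝓞 K) * two_eq hθ

/-- The case `q = r²` of `cubic_form_cases` in the cubic field: here `p - θq` is divisible exactly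
once by the prime `θ + 1`. -/
theorem sub_root_eq_root_add_one_mul_sq (B : Basis (Fin 3) ℚ K)
    (hB : ∀ i, B i = (θ : K) ^ (i : ℕ))
    (hθ : θ ^ 3 + θ ^ 2 - θ + 1 = 0) [IsPrincipalIdealRing (𝓞 K)] {p q m : ℤ}
    (hpq : IsCoprime p q) (hp : p % 2 = 1) (hq : q % 2 = 1) (hm : m % 2 = 1)
    (h : p ^ 3 + p ^ 2 * q - p * q ^ 2 + q ^ 3 = 2 * m ^ 2) :
    ∃ γ : 𝓞 K, p - θ * q = (θ + 1) * γ ^ 2 ∨ p - θ * q = -((θ + 1) * γ ^ 2) := by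
  have hcast : (p : 𝓞 K) ^ 3 + p ^ 2 * q - p * q ^ 2 + q ^ 3 = 2 * m ^ 2 := by exact_mod_cast h
  have h11 := isCoprime_eleven (e := 2) hpq (by norm_num) h
  have h3 : finrank ℚ K = 3 := by rw [Module.finrank_eq_card_basis B, Fintype.card_fin]
  have hπ0 : θ + 1 ≠ 0 := by
    intro h
    have := natAbs_norm_root_add_one h3 hθ
    rw [h, Algebra.norm_zero] at this
    norm_num at this
  obtain ⟨k, hk⟩ : ∃ k, p + q = 2 * k := ⟨(p + q) / 2, by omega⟩
  have hk' : (p : 𝓞 K) + q = 2 * k := by exact_mod_cast hk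
  have h2 := two_eq hθ
  -- the cofactors of `θ + 1` in `p - θq` and of `(θ + 1)²` in the complementary quadratic form
  obtain ⟨μ, hμ⟩ : ∃ μ : 𝓞 K, μ = (θ + 1) ^ 2 * (-θ ^ 2) * k - q := ⟨_, rfl⟩
  have hδ : p - θ * q = (θ + 1) * μ := by
    rw [hμ]; linear_combination hk' + (k : 𝓞 K) * h2
  obtain ⟨κ, hκ⟩ : ∃ κ : 𝓞 K, κ = μ ^ 2 + (3 + (θ + 1) ^ 2 * θ ^ 2) * q * μ +
    (3 + 2 * (θ + 1) ^ 2 * θ ^ 2) * q ^ 2 := ⟨_, rfl⟩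
  have hκ' : p ^ 2 + (1 + θ) * p * q + (θ ^ 2 + θ - 1) * (q : 𝓞 K) ^ 2 = (θ + 1) ^ 2 * κ := by
    have e : p ^ 2 + (1 + θ) * p * q + (θ ^ 2 + θ - 1) * (q : 𝓞 K) ^ 2 =
      (p - θ * q) ^ 2 + (3 * θ + 1) * q * (p - θ * q) + (θ + 1) * (3 * θ - 1) * q ^ 2 := by ring
    rw [e, hδ, hκ]
    linear_combination (-(θ + 1) * q * μ - 2 * (θ + 1) * (q : 𝓞 K) ^ 2) * h2
  have hprod : μ * κ = (-θ ^ 2) * (m : 𝓞 K) ^ 2 := by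
    apply mul_left_cancel₀ (pow_ne_zero 3 hπ0)
    have : (θ + 1) ^ 3 * (μ * κ) = 2 * m ^ 2 := by
      have e : (θ + 1) ^ 3 * (μ * κ) = ((θ + 1) * μ) * ((θ + 1) ^ 2 * κ) := by ring
      rw [e, ← hδ, ← hκ']
      linear_combination hcast - (q : 𝓞 K) ^ 3 * hθ
    rw [this, h2]; ring
  have hm0 : (m : 𝓞 K) ≠ 0 := by
    have : m ≠ 0 := by rintro rfl; omega
    exact_mod_cast this
  have hu : IsUnit (-θ ^ 2) := ((isUnit_root hθ).pow 2).neg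
  have hco : IsCoprime μ κ := by
    refine isCoprime_of_prime_dvd (fun h0 => ?_) fun ϖ hϖ hd hd' => ?_
    · rw [h0.1, zero_mul] at hprod
      exact mul_ne_zero hu.ne_zero (pow_ne_zero 2 hm0) hprod.symm
    · have hϖm : ϖ ∣ m := by
        refine hϖ.dvd_of_dvd_pow (n := 2) ((hu.dvd_mul_left).mp ?_)
        rw [← hprod]; exact hd.mul_right _
      have hn2 := not_dvd_two_of_dvd_odd hm hϖ.not_isUnit hϖm
      refine false_of_prime_dvd hθ hpq h11 hϖ hn2 (hδ ▸ hd.mul_left _) ?_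
      have : (3 * θ - 1) * (q : 𝓞 K) ^ 2 = (θ + 1) * (κ - μ * (μ +
          (3 + (θ + 1) ^ 2 * θ ^ 2) * q)) := by
        rw [hκ]; linear_combination -2 * (q : 𝓞 K) ^ 2 * h2
      rw [this]; exact (dvd_sub hd' (hd.mul_right _)).mul_left _
  have hassoc : Associated ((m : 𝓞 K) ^ 2) (μ * κ) := by
    rw [hprod]; exact associated_isUnit_mul_right_iff hu |>.mpr (Associated.refl _)
  obtain ⟨β, hβ⟩ := exists_associated_pow_of_associated_pow_mul hco hassoc
  obtain ⟨γ, hγ⟩ := eq_sq_or_neg_sq_of_associated B hB hθ hβ (by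
    obtain ⟨j, rfl⟩ : ∃ j, q = 2 * j + 1 := ⟨q / 2, by omega⟩
    refine ⟨-θ ^ 2 * k - (θ + 1) * (-θ ^ 2) * (j + 1), ?_⟩
    rw [hμ]; push_cast
    linear_combination (-(j : 𝓞 K) - 1) * h2)
  refine ⟨γ, hγ.imp (fun h => by rw [hδ, h]) (fun h => by rw [hδ, h]; ring)⟩

end CubicField

/-! ### Rational points of `y² = 2(x³ + x² - x + 1)` -/

section CubicField

open NumberField Module

theorem irreducible_cubic :
    Irreducible (Polynomial.X ^ 3 + Polynomial.X ^ 2 - Polynomial.X + 1 : Polynomial ℚ) := by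
  have hdeg : (Polynomial.X ^ 3 + Polynomial.X ^ 2 - Polynomial.X + 1 : Polynomial ℚ).natDegree
      = 3 := by compute_degree!
  have hmon : (Polynomial.X ^ 3 + Polynomial.X ^ 2 - Polynomial.X + 1 : Polynomial ℤ).Monic := by
    monicity!
  refine (Polynomial.irreducible_iff_roots_eq_zero_of_degree_le_three (by omega) (by omega)).mpr ?_
  refine Multiset.eq_zero_of_forall_notMem fun x hx => ?_
  have hx0 := Polynomial.isRoot_of_mem_roots hx
  have hint : IsIntegral ℤ x := by
    refine ⟨_, hmon, ?_⟩
    simpa [Polynomial.IsRoot] using hx0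
  obtain ⟨n, rfl⟩ := IsIntegrallyClosed.isIntegral_iff.mp hint
  have hn : n ^ 3 + n ^ 2 - n + 1 = 0 := by
    have : ((n : ℚ)) ^ 3 + (n : ℚ) ^ 2 - n + 1 = 0 := by simpa [Polynomial.IsRoot] using hx0
    exact_mod_cast this
  have hu : IsUnit n := IsUnit.of_mul_eq_one (-n ^ 2 - n + 1) (by linear_combination -hn)
  rcases Int.isUnit_iff.mp hu with rfl | rfl <;> norm_num at hn

theorem exists_integer_root {K : Type*} [Field K] [NumberField K] {t : K}
    (ht : t ^ 3 + t ^ 2 - t + 1 = 0) :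
    ∃ θ : 𝓞 K, (θ : K) = t ∧ θ ^ 3 + θ ^ 2 - θ + 1 = 0 := by
  have hint : IsIntegral ℤ t := by
    refine ⟨Polynomial.X ^ 3 + Polynomial.X ^ 2 - Polynomial.X + 1, by monicity!, ?_⟩
    simpa using ht
  obtain ⟨θ, rfl⟩ : ∃ θ : 𝓞 K, (θ : K) = t := ⟨⟨t, hint⟩, rfl⟩
  refine ⟨θ, rfl, RingOfIntegers.ext ?_⟩
  simpa using ht

theorem exists_cubic_field : ∃ (K : Type) (_ : Field K) (_ : NumberField K) (θ : 𝓞 K)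
    (B : Basis (Fin 3) ℚ K), θ ^ 3 + θ ^ 2 - θ + 1 = 0 ∧ ∀ i, B i = (θ : K) ^ (i : ℕ) := by
  let f : Polynomial ℚ := Polynomial.X ^ 3 + Polynomial.X ^ 2 - Polynomial.X + 1
  have : Fact (Irreducible f) := ⟨irreducible_cubic⟩
  have hdeg : f.natDegree = 3 := by simp only [f]; compute_degree!
  have hf : f ≠ 0 := irreducible_cubic.ne_zero
  have hfin : FiniteDimensional ℚ (AdjoinRoot f) := (AdjoinRoot.powerBasis hf).finite
  have hroot : (AdjoinRoot.root f) ^ 3 + (AdjoinRoot.root f) ^ 2 - AdjoinRoot.root f + 1 = 0 := by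
    have := AdjoinRoot.eval₂_root f
    simpa [f] using this
  have hK : NumberField (AdjoinRoot f) := NumberField.mk
  obtain ⟨θ, hθ, hθ'⟩ := exists_integer_root hroot
  refine ⟨AdjoinRoot f, inferInstance, hK, θ,
    (AdjoinRoot.powerBasis hf).basis.reindex (finCongr hdeg), hθ', fun i => ?_⟩
  rw [hθ]
  simp only [Basis.coe_reindex, PowerBasis.coe_basis, Function.comp_apply,
    AdjoinRoot.powerBasis_gen]
  rfl

variable {K : Type*} [Field K] [NumberField K] {θ : 𝓞 K}

/-- The image of a rational point in the cubic field modulo squares is trivial. -/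
theorem exists_sq_eq_two_mul_sub_root (B : Basis (Fin 3) ℚ K)
    (hB : ∀ i, B i = (θ : K) ^ (i : ℕ)) (hθ : θ ^ 3 + θ ^ 2 - θ + 1 = 0) {x y : ℚ}
    (h : y ^ 2 = 2 * (x ^ 3 + x ^ 2 - x + 1)) : ∃ ξ : K, 2 * ((x : K) - θ) = ξ ^ 2 := by
  have hθK : (θ : K) ^ 3 + (θ : K) ^ 2 - θ + 1 = 0 := by
    have := congrArg (algebraMap (𝓞 K) K) hθ
    simpa using this
  have := isPrincipalIdealRing_cubic B hθK hB
  have hq0 : (x.den : ℚ) ≠ 0 := by simp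
  have hx : x * x.den = x.num := Rat.mul_den_eq_num x
  obtain ⟨w, hw⟩ := isSquare_int_of_rat (r := 1) (b := y * (x.den : ℚ) ^ 2) one_ne_zero
    (n := 2 * x.den * (x.num ^ 3 + x.num ^ 2 * x.den - x.num * x.den ^ 2 + x.den ^ 3)) (by
      push_cast; rw [← hx]; linear_combination -(x.den : ℚ) ^ 4 * h)
  have hco : IsCoprime x.num x.den := by
    rw [Int.isCoprime_iff_gcd_eq_one]; simpa [Int.gcd, Nat.Coprime] using x.reduced
  have hpos : (0 : ℤ) < x.den := by exact_mod_cast x.pos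
  obtain ⟨r, m, hp, hm, hcase⟩ := cubic_form_cases hco hpos hw
  have hqK : (x.den : K) ≠ 0 := by exact_mod_cast x.den_nz
  have hxK : (x : K) * x.den = x.num := by exact_mod_cast congrArg (Rat.cast : ℚ → K) hx
  have key : ∃ ξ : K, 2 * ((x : K) - θ) = ξ ^ 2 ∨ 2 * ((x : K) - θ) = -ξ ^ 2 := by
    rcases hcase with ⟨hq, hF⟩ | ⟨hq, hq2, hF⟩
    · obtain ⟨γ, hγ⟩ := sub_root_eq_sq B hB hθ hco hp (by omega) hm hF
      have hqr : (x.den : K) = 2 * (r : K) ^ 2 := by exact_mod_cast congrArg (Int.cast : ℤ → K) hq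
      have hr : (r : K) ≠ 0 := by rintro h0; rw [h0] at hqr; simp at hqr
      have e : 2 * ((x : K) - θ) * (r : K) ^ 2 = x.num - θ * (x.den : K) := by
        rw [← hxK, hqr]; ring
      refine ⟨γ / r, hγ.imp (fun h => ?_) (fun h => ?_)⟩ <;>
      · have h' := congrArg (algebraMap (𝓞 K) K) h
        simp only [map_sub, map_mul, map_intCast, map_pow, map_neg, Int.cast_natCast,
          map_natCast] at h'
        rw [div_pow]
        field_simp
        rw [e, h']
    · obtain ⟨γ, hγ⟩ := sub_root_eq_root_add_one_mul_sq B hB hθ hco hp hq2 hm hF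
      have hqr : (x.den : K) = (r : K) ^ 2 := by exact_mod_cast congrArg (Int.cast : ℤ → K) hq
      have hr : (r : K) ≠ 0 := by rintro h0; rw [h0] at hqr; simp at hqr
      have e : 2 * ((x : K) - θ) * (r : K) ^ 2 = 2 * (x.num - θ * (x.den : K)) := by
        rw [← hxK, hqr]; ring
      have h2 := two_eq hθK
      refine ⟨(θ + 1) ^ 2 * θ * γ / r, hγ.symm.imp (fun h => ?_) (fun h => ?_)⟩ <;>
      · have h' := congrArg (algebraMap (𝓞 K) K) h
        simp only [map_sub, map_mul, map_intCast, map_pow, map_neg, Int.cast_natCast,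
          map_natCast, map_add, map_one] at h'
        rw [div_pow]
        field_simp
        rw [e, h', h2]
        ring
  obtain ⟨ξ, hξ | hξ⟩ := key
  · exact ⟨ξ, hξ⟩
  · -- the norm of `2(x - θ)` is a square, that of `-ξ²` is minus a square
    have hn := congrArg (Algebra.norm ℚ) hξ
    have h2 : (2 : K) = algebraMap ℚ K 2 := by simp
    have h1 : -ξ ^ 2 = algebraMap ℚ K (-1) * ξ ^ 2 := by simp
    have hx' : (x : K) = algebraMap ℚ K x := by simp
    rw [h1, h2, hx', map_mul, map_mul, norm_sub_cubic B hθK hB, Algebra.norm_algebraMap,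
      Algebra.norm_algebraMap, Module.finrank_eq_card_basis B, Fintype.card_fin, map_pow] at hn
    have hξ0 : Algebra.norm ℚ ξ = 0 := by
      have : (Algebra.norm ℚ ξ) ^ 2 = -(2 * y) ^ 2 := by linear_combination hn + 4 * h
      exact pow_eq_zero_iff two_ne_zero |>.mp (by nlinarith [sq_nonneg (Algebra.norm ℚ ξ)])
    rw [Algebra.norm_eq_zero_iff] at hξ0
    exact ⟨0, by rw [hξ, hξ0]; simp⟩

/-- If `2(x - θ)` is a square in the cubic field, the point `x` is the double of a rational
point: a multiple `cθ + d` of the square root that is linear in `θ` gives the tangent line. -/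
theorem exists_half_of_sq (B : Basis (Fin 3) ℚ K)
    (hB : ∀ i, B i = (θ : K) ^ (i : ℕ)) (hθ : θ ^ 3 + θ ^ 2 - θ + 1 = 0) {x : ℚ} {ξ : K}
    (h : 2 * ((x : K) - θ) = ξ ^ 2) :
    ∃ s t : ℚ, t ^ 2 = 2 * (s ^ 3 + s ^ 2 - s + 1) ∧
      x * (4 * (s ^ 3 + s ^ 2 - s + 1)) = s ^ 4 + 2 * s ^ 2 - 8 * s - 3 := by
  have hθK : (θ : K) ^ 3 + (θ : K) ^ 2 - θ + 1 = 0 := by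
    have := congrArg (algebraMap (𝓞 K) K) hθ
    simpa using this
  obtain ⟨a, b, c, habc⟩ : ∃ a b c : ℚ, ξ = a + b * θ + c * (θ : K) ^ 2 := by
    refine ⟨B.repr ξ 0, B.repr ξ 1, B.repr ξ 2, ?_⟩
    conv_lhs => rw [← B.sum_repr ξ]
    simp [Fin.sum_univ_three, hB, Algebra.smul_def]
  have hrel : ((a ^ 2 - 2 * b * c + c ^ 2 - 2 * x : ℚ) : K) +
      ((2 * a * b + 2 * b * c - 2 * c ^ 2 + 2 : ℚ) : K) * θ +
      ((b ^ 2 + 2 * a * c - 2 * b * c + 2 * c ^ 2 : ℚ) : K) * (θ : K) ^ 2 = 0 := by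
    rw [habc] at h
    push_cast
    linear_combination -h - ((c : K) ^ 2 * θ - (c : K) ^ 2 + 2 * b * c) * hθK
  have hlin := Fintype.linearIndependent_iff.mp B.linearIndependent
    ![a ^ 2 - 2 * b * c + c ^ 2 - 2 * x, 2 * a * b + 2 * b * c - 2 * c ^ 2 + 2,
      b ^ 2 + 2 * a * c - 2 * b * c + 2 * c ^ 2] (by
        simpa [Fin.sum_univ_three, hB, Algebra.smul_def] using hrel)
  have e0 : a ^ 2 - 2 * b * c + c ^ 2 - 2 * x = 0 := hlin 0
  have e1 : 2 * a * b + 2 * b * c - 2 * c ^ 2 + 2 = 0 := hlin 1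
  have e2 : b ^ 2 + 2 * a * c - 2 * b * c + 2 * c ^ 2 = 0 := hlin 2
  have hc : c ≠ 0 := by
    rintro rfl
    have hb : b = 0 := by nlinarith
    rw [hb] at e1; norm_num at e1
  obtain ⟨d, rfl⟩ : ∃ d, b = c * d := ⟨b / c, by field_simp⟩
  -- `s = d - 1` is the root of the linear factor `cT + c - b`
  have ha : a = -c * (d ^ 2 - 2 * d + 2) / 2 := by
    field_simp
    have : c * (2 * a + c * (d ^ 2 - 2 * d + 2)) = 0 := by linear_combination e2
    rcases mul_eq_zero.mp this with h0 | h0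
    · exact absurd h0 hc
    · linear_combination h0
  subst ha
  obtain ⟨s, rfl⟩ : ∃ s, d = s + 1 := ⟨d - 1, by ring⟩
  have e1' : c ^ 2 * (s ^ 3 + s ^ 2 - s + 1) = 2 := by linear_combination -e1
  have hx : x = c ^ 2 * (s ^ 4 + 2 * s ^ 2 - 8 * s - 3) / 8 := by linear_combination -e0 / 2
  refine ⟨s, c * (s ^ 3 + s ^ 2 - s + 1), ?_, ?_⟩
  · linear_combination (s ^ 3 + s ^ 2 - s + 1) * e1'
  · rw [hx]; linear_combination (s ^ 4 + 2 * s ^ 2 - 8 * s - 3) / 2 * e1'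

end CubicField

theorem exists_half {x y : ℚ} (h : y ^ 2 = 2 * (x ^ 3 + x ^ 2 - x + 1)) :
    ∃ s t : ℚ, t ^ 2 = 2 * (s ^ 3 + s ^ 2 - s + 1) ∧
      x * (4 * (s ^ 3 + s ^ 2 - s + 1)) = s ^ 4 + 2 * s ^ 2 - 8 * s - 3 := by
  obtain ⟨K, _, _, θ, B, hθ, hB⟩ := exists_cubic_field
  obtain ⟨ξ, hξ⟩ := exists_sq_eq_two_mul_sub_root B hB hθ h
  exact exists_half_of_sq B hB hθ hξ

/-- The duplication formula raises heights to the fourth power up to a bounded factor: the two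
forms of degree four have no common factor beyond divisors of `176`, and the larger of their values
is at least a third of the fourth power of the height. -/
theorem height_pow_four_le {p q a b : ℤ} (hpq : IsCoprime p q) (hab : IsCoprime a b) (hq : 0 < q)
    (hF : p ^ 3 + p ^ 2 * q - p * q ^ 2 + q ^ 3 ≠ 0)
    (h : a * (4 * q * (p ^ 3 + p ^ 2 * q - p * q ^ 2 + q ^ 3)) =
      b * (p ^ 4 + 2 * p ^ 2 * q ^ 2 - 8 * p * q ^ 3 - 3 * q ^ 4)) :
    max |p| q ^ 4 ≤ 528 * max |a| |b| := by
  set N := p ^ 4 + 2 * p ^ 2 * q ^ 2 - 8 * p * q ^ 3 - 3 * q ^ 4 with hN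
  set F := p ^ 3 + p ^ 2 * q - p * q ^ 2 + q ^ 3 with hFd
  have hb : b ∣ 4 * q * F := hab.symm.dvd_of_dvd_mul_left (Dvd.intro _ h.symm)
  obtain ⟨g, hg⟩ := hb
  have hD0 : 4 * q * F ≠ 0 := mul_ne_zero (by omega) hF
  have hb0 : b ≠ 0 := by rintro rfl; rw [hg] at hD0; simp at hD0
  have hgN : N = a * g := by
    apply mul_left_cancel₀ hb0
    rw [← h, hg]; ring
  have hgq : IsCoprime g q := by
    have h1 : IsCoprime (p ^ 4) q := hpq.pow_left
    have h2 : IsCoprime N q := by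
      have := (IsCoprime.add_mul_right_left_iff
        (z := 2 * p ^ 2 * q - 8 * p * q ^ 2 - 3 * q ^ 3)).mpr h1
      rwa [show p ^ 4 + (2 * p ^ 2 * q - 8 * p * q ^ 2 - 3 * q ^ 3) * q = N by rw [hN]; ring] at this
    exact IsCoprime.of_mul_left_right (hgN ▸ h2)
  have hg176 : g ∣ 176 := by
    have h1 : g ∣ q * (176 * p ^ 6) := by
      have : q * (176 * p ^ 6) = 4 * q * (5 * q ^ 2 - 8 * p * q + 11 * p ^ 2) * N +
          (15 * q ^ 3 + 31 * p * q ^ 2 - 25 * p ^ 2 * q + 33 * p ^ 3) * (4 * q * F) := by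
        rw [hN, hFd]; ring
      rw [this]
      exact dvd_add (Dvd.dvd.mul_left (hgN ▸ Dvd.intro_left a rfl) _)
        (Dvd.dvd.mul_left (hg ▸ Dvd.intro_left b rfl) _)
    have h2 : g ∣ q * (176 * q ^ 6) := by
      have : q * (176 * q ^ 6) = 4 * q * (-5 * q ^ 2 + 2 * p * q + 3 * p ^ 2) * N +
          (29 * q ^ 3 - 5 * p * q ^ 2 + p ^ 2 * q - 3 * p ^ 3) * (4 * q * F) := by
        rw [hN, hFd]; ring
      rw [this]
      exact dvd_add (Dvd.dvd.mul_left (hgN ▸ Dvd.intro_left a rfl) _)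
        (Dvd.dvd.mul_left (hg ▸ Dvd.intro_left b rfl) _)
    have h3 := hgq.dvd_of_dvd_mul_left h1
    have h4 := hgq.dvd_of_dvd_mul_left h2
    rw [show p ^ 6 = (p ^ 3) ^ 2 by ring] at h3
    rw [show q ^ 6 = (q ^ 3) ^ 2 by ring] at h4
    exact dvd_of_dvd_mul_sq hpq.pow h3 h4
  have hgle : |g| ≤ 176 := Int.le_of_dvd (by norm_num) ((abs_dvd g 176).mpr hg176)
  have hM0 : 0 ≤ max |a| |b| := (abs_nonneg a).trans (le_max_left _ _)
  have hNle : |N| ≤ 176 * max |a| |b| := by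
    rw [hgN, abs_mul, mul_comm]
    exact mul_le_mul hgle (le_max_left _ _) (abs_nonneg _) (by norm_num)
  have hDle : |4 * q * F| ≤ 176 * max |a| |b| := by
    rw [hg, abs_mul, mul_comm]
    exact mul_le_mul hgle (le_max_right _ _) (abs_nonneg _) (by norm_num)
  have hN1 := le_abs_self N
  have hD1 := le_abs_self (4 * q * F)
  rcases le_total |p| q with hle | hle
  · rw [max_eq_right hle]
    obtain ⟨h1, h2⟩ := abs_le.mp hle
    have : q ^ 4 ≤ 4 * q * F := by
      have : q ^ 3 ≤ 4 * F := by
        have e : 4 * F - q ^ 3 = 4 * p ^ 2 * (p + q) + q ^ 2 * (3 * q - 4 * p) := by rw [hFd]; ring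
        have e' : 0 ≤ 4 * p ^ 2 * (p + q) + q ^ 2 * (3 * q - 4 * p) := by
          nlinarith [mul_nonneg (by linarith : 0 ≤ p + q) (sq_nonneg (2 * p - q)),
            mul_nonneg hq.le (sq_nonneg (2 * p - q)),
            mul_nonneg (by linarith : 0 ≤ q - p) (sq_nonneg q)]
        linarith
      have := mul_le_mul_of_nonneg_left this hq.le
      linarith [show q * q ^ 3 = q ^ 4 by ring, show q * (4 * F) = 4 * q * F by ring]
    linarith
  · rw [max_eq_left hle]
    rw [show |p| ^ 4 = p ^ 4 by rw [show 4 = 2 * 2 by norm_num, pow_mul, sq_abs, ← pow_mul]]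
    rcases le_total 0 p with hp | hp
    · rw [abs_of_nonneg hp] at hle
      have e : N + 2 * (4 * q * F) - p ^ 4 =
          q * (8 * p * (p - q) ^ 2 + 26 * p * q * (p - q) + 2 * p * q ^ 2 + 5 * q ^ 3) := by
        rw [hN, hFd]; ring
      have e' : 0 ≤ q * (8 * p * (p - q) ^ 2 + 26 * p * q * (p - q) + 2 * p * q ^ 2 + 5 * q ^ 3) := by
        have : 0 ≤ p - q := by linarith
        positivity
      linarith
    · rw [abs_of_nonpos hp] at hle
      have e : N - p ^ 4 = q ^ 2 * (2 * p ^ 2 + q * (8 * (-p - q) + 5 * q)) := by rw [hN]; ring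
      have e' : 0 ≤ q ^ 2 * (2 * p ^ 2 + q * (8 * (-p - q) + 5 * q)) := by
        have : 0 ≤ -p - q := by linarith
        positivity
      linarith

/-- For small arguments other than `±1` the cubic form is negative or a quadratic nonresidue for
one of four moduli. -/
theorem small_values_nonresidue : ∀ p ∈ Finset.Icc (-8 : ℤ) 8, ∀ q ∈ Finset.Icc (1 : ℤ) 8,
    p = q ∨ p = -q ∨ 2 * q * (p ^ 3 + p ^ 2 * q - p * q ^ 2 + q ^ 3) < 0 ∨
      ∃ m ∈ [16, 9, 17, 37], ∀ x ∈ List.range m,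
        (x * x) % m ≠ ((2 * q * (p ^ 3 + p ^ 2 * q - p * q ^ 2 + q ^ 3)) % m).toNat := by
  decide +kernel

theorem eq_or_eq_neg_of_small {p q w : ℤ} (hp : |p| ≤ 8) (hq : 0 < q) (hq8 : q ≤ 8)
    (h : 2 * q * (p ^ 3 + p ^ 2 * q - p * q ^ 2 + q ^ 3) = w ^ 2) : p = q ∨ p = -q := by
  obtain ⟨h1, h2⟩ := abs_le.mp hp
  rcases small_values_nonresidue p (by simp; omega) q (by simp; omega) with h0 | h0 | h0 | h0
  · exact Or.inl h0
  · exact Or.inr h0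
  · rw [h] at h0; nlinarith [sq_nonneg w]
  · exfalso
    obtain ⟨m, hm, hx⟩ := h0
    have hm0 : 0 < m := by simp at hm; omega
    refine hx (w.natAbs % m) (by simpa using Nat.mod_lt _ hm0) ?_
    have hw : w ^ 2 = ((w.natAbs * w.natAbs : ℕ) : ℤ) := by
      rw [Nat.cast_mul, Int.natAbs_mul_self', sq]
    rw [h, hw, ← Nat.mul_mod, ← Int.natCast_mod, Int.toNat_natCast]

theorem eq_one_or_neg_one_of_height_le (n : ℕ) : ∀ x y : ℚ, max |x.num| x.den ≤ n →
    y ^ 2 = 2 * (x ^ 3 + x ^ 2 - x + 1) → x = 1 ∨ x = -1 := by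
  induction n using Nat.strong_induction_on with
  | _ n ih =>
    intro x y hn h
    obtain ⟨s, t, hs, hxs⟩ := exists_half h
    have hco : ∀ x : ℚ, IsCoprime x.num x.den := fun x => by
      rw [Int.isCoprime_iff_gcd_eq_one]; simpa [Int.gcd, Nat.Coprime] using x.reduced
    have hsd : (s.den : ℚ) ≠ 0 := by simp
    have hxd : (x.den : ℚ) ≠ 0 := by simp
    have hsn : s * s.den = s.num := Rat.mul_den_eq_num s
    have hxn : x * x.den = x.num := Rat.mul_den_eq_num x
    have hpos : (0 : ℤ) < s.den := by exact_mod_cast s.pos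
    have hs1 : s = 1 ∨ s = -1 := by
      -- heights above `8` decrease strictly, since `528 < 9 ^ 3`
      by_cases hsmall : |s.num| ≤ 8 ∧ (s.den : ℤ) ≤ 8
      · obtain ⟨w, hw⟩ := isSquare_int_of_rat (r := 1) (b := t * (s.den : ℚ) ^ 2) one_ne_zero
          (n := 2 * s.den * (s.num ^ 3 + s.num ^ 2 * s.den - s.num * s.den ^ 2 + s.den ^ 3)) (by
            push_cast; rw [← hsn]; linear_combination -(s.den : ℚ) ^ 4 * hs)
        rcases eq_or_eq_neg_of_small hsmall.1 hpos hsmall.2 hw with h0 | h0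
        · left; apply mul_right_cancel₀ hsd; rw [hsn, h0]; simp
        · right; apply mul_right_cancel₀ hsd; rw [hsn, h0]; simp
      · have hbig : 9 ≤ max |s.num| (s.den : ℤ) := by
          by_contra hlt
          exact hsmall (max_le_iff.mp (by omega))
        have hF : s.num ^ 3 + s.num ^ 2 * s.den - s.num * s.den ^ 2 + (s.den : ℤ) ^ 3 ≠ 0 := by
          intro h0
          have h1 : s ^ 3 + s ^ 2 - s + 1 = 0 := by
            have : ((s.num : ℚ)) ^ 3 + (s.num : ℚ) ^ 2 * s.den - s.num * (s.den : ℚ) ^ 2 +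
              (s.den : ℚ) ^ 3 = 0 := by exact_mod_cast h0
            apply mul_left_cancel₀ (pow_ne_zero 3 hsd)
            rw [← hsn] at this
            linear_combination this
          have h2 : s ^ 4 + 2 * s ^ 2 - 8 * s - 3 = 0 := by rw [← hxs, h1]; ring
          have : (44 : ℚ) = 0 := by
            linear_combination (29 - 5 * s + s ^ 2 - 3 * s ^ 3) * h1 +
              (-5 + 2 * s + 3 * s ^ 2) * h2
          norm_num at this
        have hle := height_pow_four_le (hco s) (hco x) hpos hF (by
          have : ((x.num * (4 * s.den * (s.num ^ 3 + s.num ^ 2 * s.den - s.num * s.den ^ 2 +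
              s.den ^ 3)) : ℤ) : ℚ) = (x.den * (s.num ^ 4 + 2 * s.num ^ 2 * s.den ^ 2 -
              8 * s.num * s.den ^ 3 - 3 * s.den ^ 4) : ℤ) := by
            push_cast
            rw [← hsn, ← hxn]
            linear_combination (x.den * s.den ^ 4 : ℚ) * hxs
          exact_mod_cast this)
        set H := max |s.num| (s.den : ℤ)
        have hlt : H < n := by
          have h9 : 729 ≤ H ^ 3 := by
            calc (729 : ℤ) = 9 ^ 3 := by norm_num
              _ ≤ H ^ 3 := pow_le_pow_left₀ (by norm_num) hbig 3
          have : max |x.num| |(x.den : ℤ)| ≤ n := by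
            rwa [abs_of_nonneg (by positivity : (0 : ℤ) ≤ x.den)]
          nlinarith
        exact ih H.toNat (by omega) s t (Int.self_le_toNat _) hs
    rcases hs1 with rfl | rfl
    · right; linarith
    · left; linarith

/-- The affine rational points of `y² = 2(x³ + x² - x + 1)`, a model of `X₁(11)`. -/
theorem eq_one_or_neg_one_of_sq_eq_cubic {x y : ℚ} (h : y ^ 2 = 2 * (x ^ 3 + x ^ 2 - x + 1)) :
    x = 1 ∨ x = -1 :=
  eq_one_or_neg_one_of_height_le (max |x.num| x.den).toNat x y (Int.self_le_toNat _) h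

/-! ### Rational points of the fibre product over the line -/

/-- Up to a power of `2` the cubic and the quartic form are coprime, so if their product is a
square, the quartic form is a square up to sign. -/
theorem quartic_eq_sq_or_neg_sq {p q w : ℤ} (hpq : IsCoprime p q)
    (h : 2 * q * (p ^ 3 + p ^ 2 * q - p * q ^ 2 + q ^ 3) *
      ((p ^ 2 + q ^ 2) * (3 * q ^ 2 - p ^ 2)) = w ^ 2) :
    ∃ m : ℤ, (p ^ 2 + q ^ 2) * (3 * q ^ 2 - p ^ 2) = m ^ 2 ∨
      (p ^ 2 + q ^ 2) * (3 * q ^ 2 - p ^ 2) = -m ^ 2 := by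
  -- an odd divisor of the quartic form is coprime to the other factor
  have hco : ∀ G' k : ℤ, (p ^ 2 + q ^ 2) * (3 * q ^ 2 - p ^ 2) = G' * k → G' % 2 = 1 →
      IsCoprime G' (2 * q * (p ^ 3 + p ^ 2 * q - p * q ^ 2 + q ^ 3)) := by
    intro G' k hG hodd
    refine isCoprime_of_prime_dvd (by rintro ⟨rfl, -⟩; omega) fun ℓ hℓ h1 h2 => ?_
    have hn2 : ¬ ℓ ∣ 2 := not_dvd_two_of_dvd_odd hodd hℓ.not_isUnit (by exact_mod_cast h1)
    have hG' : ℓ ∣ (p ^ 2 + q ^ 2) * (3 * q ^ 2 - p ^ 2) := hG ▸ h1.mul_right k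
    have hboth : ¬ (ℓ ∣ p ∧ ℓ ∣ q) := fun hh => hℓ.not_isUnit (hpq.isUnit_of_dvd' hh.1 hh.2)
    rcases hℓ.dvd_or_dvd h2 with h3 | h3
    · have hq := (hℓ.dvd_or_dvd h3).resolve_left hn2
      refine hboth ⟨hℓ.dvd_of_dvd_pow (n := 4) ?_, hq⟩
      have e : p ^ 4 = q * (3 * q ^ 3 + 2 * p ^ 2 * q) -
        (p ^ 2 + q ^ 2) * (3 * q ^ 2 - p ^ 2) := by ring
      rw [e]; exact dvd_sub (hq.mul_right _) hG'
    · have hn4 : ¬ ℓ ∣ 4 := fun h4 => hn2 (hℓ.dvd_of_dvd_pow (n := 2) (by norm_num; exact h4))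
      have hq : ℓ ∣ 4 * q ^ 6 := by
        have e : 4 * q ^ 6 = (q ^ 2 - p ^ 2) * ((p ^ 2 + q ^ 2) * (3 * q ^ 2 - p ^ 2)) +
          (q ^ 3 + p * q ^ 2 + p ^ 2 * q - p ^ 3) *
            (p ^ 3 + p ^ 2 * q - p * q ^ 2 + q ^ 3) := by ring
        rw [e]; exact dvd_add (hG'.mul_left _) (h3.mul_left _)
      have hp : ℓ ∣ 4 * p ^ 6 := by
        have e : 4 * p ^ 6 = (-9 * q ^ 2 + 14 * p * q - 17 * p ^ 2) *
          ((p ^ 2 + q ^ 2) * (3 * q ^ 2 - p ^ 2)) +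
          (27 * q ^ 3 - 15 * p * q ^ 2 + 27 * p ^ 2 * q - 13 * p ^ 3) *
            (p ^ 3 + p ^ 2 * q - p * q ^ 2 + q ^ 3) := by ring
        rw [e]; exact dvd_add (hG'.mul_left _) (h3.mul_left _)
      exact hboth ⟨hℓ.dvd_of_dvd_pow ((hℓ.dvd_or_dvd hp).resolve_left hn4),
        hℓ.dvd_of_dvd_pow ((hℓ.dvd_or_dvd hq).resolve_left hn4)⟩
  set F := 2 * q * (p ^ 3 + p ^ 2 * q - p * q ^ 2 + q ^ 3)
  have odd_sq : ∀ a : ℤ, a % 2 = 1 → ∃ i, a ^ 2 = 8 * i + 1 := fun a ha =>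
    ⟨a ^ 2 / 8, by have := sq_emod_eight_of_odd ha; omega⟩
  have even_sq : ∀ a : ℤ, a % 2 = 0 → ∃ i, a ^ 2 = 4 * i := fun a ha =>
    ⟨a ^ 2 / 4, by have := sq_emod_sixteen_of_even ha; omega⟩
  have mixed : ((p ^ 2 + q ^ 2) * (3 * q ^ 2 - p ^ 2)) % 2 = 1 →
      ∃ m : ℤ, (p ^ 2 + q ^ 2) * (3 * q ^ 2 - p ^ 2) = m ^ 2 ∨
      (p ^ 2 + q ^ 2) * (3 * q ^ 2 - p ^ 2) = -m ^ 2 := fun hodd =>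
    Int.sq_of_isCoprime (hco _ 1 (by ring) hodd) ((mul_comm _ _).trans h)
  rcases Int.emod_two_eq_zero_or_one p with hp2 | hp2 <;>
  rcases Int.emod_two_eq_zero_or_one q with hq2 | hq2
  · have := hpq.isUnit_of_dvd' (Int.dvd_of_emod_eq_zero hp2) (Int.dvd_of_emod_eq_zero hq2)
    norm_num [Int.isUnit_iff] at this
  · obtain ⟨i, hi⟩ := even_sq p hp2
    obtain ⟨j, hj⟩ := odd_sq q hq2
    apply mixed
    rw [hi, hj, Int.mul_emod, show (4 * i + (8 * j + 1)) % 2 = 1 by omega,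
      show (3 * (8 * j + 1) - 4 * i) % 2 = 1 by omega]
    norm_num
  · obtain ⟨i, hi⟩ := odd_sq p hp2
    obtain ⟨j, hj⟩ := even_sq q hq2
    apply mixed
    rw [hi, hj, Int.mul_emod, show (8 * i + 1 + 4 * j) % 2 = 1 by omega,
      show (3 * (4 * j) - (8 * i + 1)) % 2 = 1 by omega]
    norm_num
  · obtain ⟨i, hi⟩ := odd_sq p hp2
    obtain ⟨j, hj⟩ := odd_sq q hq2
    have hG : (p ^ 2 + q ^ 2) * (3 * q ^ 2 - p ^ 2) =
        (4 * i + 4 * j + 1) * (12 * j - 4 * i + 1) * 4 := by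
      rw [hi, hj]; ring
    have hodd : ((4 * i + 4 * j + 1) * (12 * j - 4 * i + 1)) % 2 = 1 := by
      rw [Int.mul_emod, show (4 * i + 4 * j + 1) % 2 = 1 by omega,
        show (12 * j - 4 * i + 1) % 2 = 1 by omega]
      norm_num
    have hw2 : w % 2 = 0 := by
      rcases Int.emod_two_eq_zero_or_one w with h2 | h2
      · exact h2
      · have := sq_emod_eight_of_odd h2
        rw [← h, hG, ← mul_assoc] at this
        omega
    obtain ⟨v, rfl⟩ : ∃ v, w = 2 * v := ⟨w / 2, by omega⟩
    obtain ⟨m, hm⟩ := Int.sq_of_isCoprime (hco _ 4 hG hodd) (c := v) (by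
      rw [hG] at h; linarith)
    refine ⟨2 * m, hm.imp (fun hm => ?_) (fun hm => ?_)⟩ <;> rw [hG, hm] <;> ring

/-- A rational `x` at which the cubic and the quartic differ by a square factor. -/
theorem sq_eq_one_of_quartic_eq_sq_mul_cubic {x b : ℚ}
    (h : (x ^ 2 + 1) * (3 - x ^ 2) = b ^ 2 * (2 * (x ^ 3 + x ^ 2 - x + 1))) : x ^ 2 = 1 := by
  have hx : x * x.den = x.num := Rat.mul_den_eq_num x
  have hd : (x.den : ℚ) ≠ 0 := by simp
  have hco : IsCoprime x.num x.den := by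
    rw [Int.isCoprime_iff_gcd_eq_one]; simpa [Int.gcd, Nat.Coprime] using x.reduced
  obtain ⟨w, hw⟩ := isSquare_int_of_rat (r := 1)
    (b := b * (2 * x.den * (x.num ^ 3 + x.num ^ 2 * x.den - x.num * x.den ^ 2 + x.den ^ 3)))
    one_ne_zero
    (n := 2 * x.den * (x.num ^ 3 + x.num ^ 2 * x.den - x.num * x.den ^ 2 + x.den ^ 3) *
      ((x.num ^ 2 + x.den ^ 2) * (3 * x.den ^ 2 - x.num ^ 2))) (by
      push_cast; rw [← hx]
      linear_combination (2 * (x.den : ℚ) ^ 8 * (x ^ 3 + x ^ 2 - x + 1)) * h)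
  obtain ⟨m, hm⟩ := quartic_eq_sq_or_neg_sq hco hw
  rcases hm with hm | hm
  · apply sq_eq_one_of_quartic_eq_sq (z := m / (x.den : ℚ) ^ 2)
    have hm' : ((x.num : ℚ) ^ 2 + (x.den : ℚ) ^ 2) * (3 * (x.den : ℚ) ^ 2 - (x.num : ℚ) ^ 2) =
      (m : ℚ) ^ 2 := by exact_mod_cast hm
    rw [div_pow, ← hm', ← hx]
    field_simp
  · exfalso
    refine quartic_twist_ne_sq (x := x) (z := m / (x.den : ℚ) ^ 2) ?_
    have hm' : ((x.num : ℚ) ^ 2 + (x.den : ℚ) ^ 2) * (3 * (x.den : ℚ) ^ 2 - (x.num : ℚ) ^ 2) =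
      -(m : ℚ) ^ 2 := by exact_mod_cast hm
    rw [div_pow, show (m : ℚ) ^ 2 = -(-(m : ℚ) ^ 2) by ring, ← hm', ← hx]
    field_simp
    ring

/-! ### Quadratic points -/

section QuadraticField

variable {K : Type*} [Field K] [NumberField K]

theorem eq_zero_of_add_mul_eq_zero {x : K} (hx : ∀ r : ℚ, x ≠ r) {a b : ℚ}
    (h : (a : K) + b * x = 0) : a = 0 ∧ b = 0 := by
  by_cases hb : b = 0
  · subst hb; exact ⟨by simpa using h, rfl⟩
  · exfalso
    apply hx (-a / b)
    have : (b : K) ≠ 0 := by exact_mod_cast hb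
    push_cast
    field_simp
    linear_combination h

theorem exists_eq_add_mul (hK : Module.finrank ℚ K = 2) {x : K} (hx : ∀ r : ℚ, x ≠ r) (w : K) :
    ∃ a b : ℚ, w = a + b * x := by
  have hli : LinearIndependent ℚ ![(1 : K), x] := by
    rw [LinearIndependent.pair_iff]
    intro s t hst
    apply eq_zero_of_add_mul_eq_zero hx
    simpa [Algebra.smul_def] using hst
  have htop := hli.span_eq_top_of_card_eq_finrank' (by simp [hK])
  have hw : w ∈ Submodule.span ℚ (Set.range ![(1 : K), x]) := htop ▸ Submodule.mem_top
  rw [Matrix.range_cons, Matrix.range_cons, Matrix.range_empty, Set.union_empty,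
    Set.singleton_union, Submodule.mem_span_pair] at hw
  obtain ⟨a, b, hab⟩ := hw
  exact ⟨a, b, by rw [← hab]; simp [Algebra.smul_def]⟩

/-- The line through a quadratic point of `y² = 2(x³ + x² - x + 1)` and its conjugate meets the
cubic in a third, rational point. -/
theorem cubic_families {x : K} (hx : ∀ r : ℚ, x ≠ r) {A B : ℚ}
    (hAB : x ^ 2 + A * x + B = 0) {m n : ℚ}
    (h : ((m : K) * x + n) ^ 2 = 2 * (x ^ 3 + x ^ 2 - x + 1)) :
    ∃ M : ℚ, (2 * A = 4 - M ^ 2 ∧ 2 * B = 2 - 4 * M + M ^ 2) ∨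
      (2 * A = -M ^ 2 ∧ 2 * B = -2 - 4 * M - M ^ 2) := by
  obtain ⟨e0, e1⟩ := eq_zero_of_add_mul_eq_zero hx
    (a := 2 - n ^ 2 - B * (2 - m ^ 2 - 2 * A))
    (b := -2 - 2 * m * n - A * (2 - m ^ 2 - 2 * A) - 2 * B) (by
      push_cast
      linear_combination -h - (2 * x + (2 - m ^ 2 - 2 * A)) * hAB)
  have hr := eq_one_or_neg_one_of_sq_eq_cubic (x := -(2 - m ^ 2 - 2 * A) / 2)
    (y := m * (-(2 - m ^ 2 - 2 * A) / 2) + n)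
    (by linear_combination -e0 + (2 - m ^ 2 - 2 * A) / 2 * e1)
  rcases hr with hr | hr
  · have hA : 2 * A = 4 - m ^ 2 := by linarith
    have hn : (m + n - 2) * (m + n + 2) = 0 := by
      have : 2 - m ^ 2 - 2 * A = -2 := by linarith
      rw [this] at e0 e1
      linear_combination -e0 - e1 + hA
    rcases mul_eq_zero.mp hn with h0 | h0
    · obtain rfl : n = 2 - m := by linarith
      exact ⟨m, Or.inl ⟨hA, by linear_combination e0 - B * hA⟩⟩
    · obtain rfl : n = -2 - m := by linarith
      exact ⟨-m, Or.inl ⟨by linarith, by linear_combination e0 - B * hA⟩⟩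
  · have hA : 2 * A = -m ^ 2 := by linarith
    have hn : (n - m - 2) * (n - m + 2) = 0 := by
      have : 2 - m ^ 2 - 2 * A = 2 := by linarith
      rw [this] at e0 e1
      linear_combination -e0 + e1 + hA
    rcases mul_eq_zero.mp hn with h0 | h0
    · obtain rfl : n = 2 + m := by linarith
      exact ⟨m, Or.inr ⟨hA, by linear_combination -e0 + B * hA⟩⟩
    · obtain rfl : n = m - 2 := by linarith
      exact ⟨-m, Or.inr ⟨by linarith, by linear_combination -e0 + B * hA⟩⟩

/-- A parabola through `(1, 2)`, a quadratic point of `z² = (x² + 1)(3 - x²)` and its conjugate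
meets the quartic in one further, rational point. -/
theorem quartic_families {x : K} (hx : ∀ r : ℚ, x ≠ r) {A B : ℚ}
    (hAB : x ^ 2 + A * x + B = 0) {m n : ℚ}
    (h : ((m : K) * x + n) ^ 2 = (x ^ 2 + 1) * (3 - x ^ 2)) (h1 : 1 + A + B ≠ 0) :
    ∃ u v : ℚ, u ^ 2 + v ^ 2 = 1 ∧ ((A = 0 ∧ B = 2 * u - 1) ∨ (A = 2 * u ∧ B = 1 + 2 * v)) := by
  obtain ⟨k, M, N, hMN, hz⟩ : ∃ k M N : ℚ, k + M + N = 2 ∧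
      (k * x ^ 2 + M * x + N) ^ 2 = (x ^ 2 + 1) * (3 - x ^ 2) := by
    refine ⟨(2 - m - n) / (1 + A + B), m + (2 - m - n) / (1 + A + B) * A,
      n + (2 - m - n) / (1 + A + B) * B, by field_simp; ring, ?_⟩
    rw [← h]
    congr 1
    push_cast
    linear_combination ((2 - m - n) / (1 + A + B) : K) * hAB
  obtain rfl : N = 2 - k - M := by linarith
  -- the quotient of `(x² + 1)(3 - x²) - (kx² + Mx + N)²` by `x² + Ax + B` is `ax² + bx + c`
  obtain ⟨a, ha⟩ : ∃ a, a = -(1 + k ^ 2) := ⟨_, rfl⟩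
  obtain ⟨b, hb⟩ : ∃ b, b = -2 * k * M - A * a := ⟨_, rfl⟩
  obtain ⟨c, hc⟩ : ∃ c, c = 2 - M ^ 2 - 2 * k * (2 - k - M) - A * b - B * a := ⟨_, rfl⟩
  obtain ⟨e0, e1⟩ := eq_zero_of_add_mul_eq_zero hx
    (a := 3 - (2 - k - M) ^ 2 - B * c)
    (b := -2 * M * (2 - k - M) - A * c - B * b) (by
      rw [hc, hb, ha]
      push_cast at hz ⊢
      linear_combination -hz - (((-(1 + k ^ 2) : K)) * x ^ 2 +
        (-2 * k * M - A * (-(1 + k ^ 2))) * x + (2 - M ^ 2 - 2 * k * (2 - k - M) -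
        A * (-2 * k * M - A * (-(1 + k ^ 2))) - B * (-(1 + k ^ 2)))) * hAB)
  have ha0 : a < 0 := by rw [ha]; nlinarith [sq_nonneg k]
  have habc : b = -a - c := by
    have : (1 + A + B) * (a + b + c) = 0 := by
      linear_combination -e0 - e1 + ha + hb + hc
    rcases mul_eq_zero.mp this with h' | h'
    · exact absurd h' h1
    · linarith
  obtain ⟨r, hr⟩ : ∃ r, c = a * r := ⟨c / a, (mul_div_cancel₀ c ha0.ne).symm⟩
  have hpt : (k * r ^ 2 + M * r + (2 - k - M)) ^ 2 = (r ^ 2 + 1) * (3 - r ^ 2) := by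
    linear_combination -e0 - r * e1 + r ^ 2 * hc + r ^ 3 * hb + r ^ 4 * ha -
      (r ^ 2 + A * r + B) * (r * habc + (1 - r) * hr)
  have hk : 1 + k ^ 2 ≠ 0 := by positivity
  have huv : (2 * k / (1 + k ^ 2)) ^ 2 + ((1 - k ^ 2) / (1 + k ^ 2)) ^ 2 = 1 := by
    field_simp; ring
  have hrr : (r - 1) * (r + 1) = 0 := by
    linear_combination sq_eq_one_of_quartic_eq_sq hpt
  rcases mul_eq_zero.mp hrr with h' | h'
  · -- the parabola is tangent at `(1, 2)`
    obtain rfl : r = 1 := by linarith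
    obtain rfl : c = a := by linarith
    obtain rfl : b = -c - c := habc
    obtain rfl : M = -2 * k := by
      linear_combination (-1 / 4) * (e1 - 2 * hc - 3 * hb - 4 * ha)
    refine ⟨(1 - k ^ 2) / (1 + k ^ 2), 2 * k / (1 + k ^ 2), by rw [add_comm]; exact huv,
      Or.inr ⟨?_, ?_⟩⟩
    · rw [ha] at hb
      field_simp
      linear_combination -hb
    · rw [ha] at hb hc
      field_simp
      linear_combination -hc - 2 * hb
  · -- the parabola passes through `(-1, 2)` or `(-1, -2)`
    obtain rfl : r = -1 := by linarith
    obtain rfl : c = -a := by linarith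
    obtain rfl : b = 0 := by linarith
    have hM : M * (M - 2) = 0 := by linear_combination hpt / 4
    rcases mul_eq_zero.mp hM with h0 | h0
    · subst h0
      refine ⟨2 * k / (1 + k ^ 2), (1 - k ^ 2) / (1 + k ^ 2), huv, Or.inl ⟨?_, ?_⟩⟩
      · have : A * a = 0 := by linear_combination hb
        exact (mul_eq_zero.mp this).resolve_right ha0.ne
      · rw [ha] at hc
        field_simp
        linear_combination -hc
    · obtain rfl : M = 2 := by linarith
      refine ⟨2 * k / (1 + k ^ 2), (1 - k ^ 2) / (1 + k ^ 2), huv, Or.inr ⟨?_, ?_⟩⟩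
      · rw [ha] at hb
        field_simp
        linear_combination -hb
      · rw [ha] at hc
        field_simp
        linear_combination -hc

/-- The families of minimal polynomials coming from the two elliptic curves meet only in
polynomials with a root `±1`. -/
theorem families_disjoint {A B M u v : ℚ} (huv : u ^ 2 + v ^ 2 = 1)
    (h1 : (2 * A = 4 - M ^ 2 ∧ 2 * B = 2 - 4 * M + M ^ 2) ∨
      (2 * A = -M ^ 2 ∧ 2 * B = -2 - 4 * M - M ^ 2))
    (h2 : (A = 0 ∧ B = 2 * u - 1) ∨ (A = 2 * u ∧ B = 1 + 2 * v)) :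
    1 + A + B = 0 ∨ 1 - A + B = 0 := by
  rcases h2 with ⟨rfl, rfl⟩ | ⟨rfl, rfl⟩ <;> rcases h1 with ⟨hA, hB⟩ | ⟨hA, hB⟩
  · have hM : (M - 2) * (M + 2) = 0 := by linear_combination hA
    rcases mul_eq_zero.mp hM with h0 | h0
    · obtain rfl : M = 2 := by linarith
      left; linarith
    · obtain rfl : M = -2 := by linarith
      obtain rfl : u = 4 := by linarith
      nlinarith [sq_nonneg v]
  · have hM : M = 0 := pow_eq_zero_iff two_ne_zero |>.mp (by linarith)
    subst hM
    left; linarith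
  · have hu : u = 1 - M ^ 2 / 4 := by linarith
    have hv : v = M ^ 2 / 4 - M := by linarith
    subst hu hv
    have hM : M * (M - 2) = 0 :=
      pow_eq_zero_iff two_ne_zero |>.mp (by linear_combination 8 * huv)
    rcases mul_eq_zero.mp hM with rfl | h0
    · right; norm_num
    · obtain rfl : M = 2 := by linarith
      left; norm_num
  · have hu : u = -M ^ 2 / 4 := by linarith
    have hv : v = -(1 + M + M ^ 2 / 4) := by linarith
    subst hu hv
    have hM : M * ((M + 2) * (M ^ 2 + 2 * M + 8)) = 0 := by linear_combination 8 * huv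
    rcases mul_eq_zero.mp hM with rfl | h0
    · left; norm_num
    · rcases mul_eq_zero.mp h0 with h0 | h0
      · obtain rfl : M = -2 := by linarith
        left; norm_num
      · nlinarith [sq_nonneg (M + 1)]

/-- Over a quadratic field the curve `y² = 2(x³ + x² - x + 1)`, `z² = (x² + 1)(3 - x²)` of genus
five has no points other than those with `x = ±1`. -/
theorem sq_eq_one_of_quadratic_point (hK : Module.finrank ℚ K = 2) {x y z : K}
    (hy : y ^ 2 = 2 * (x ^ 3 + x ^ 2 - x + 1)) (hz : z ^ 2 = (x ^ 2 + 1) * (3 - x ^ 2)) :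
    x ^ 2 = 1 := by
  by_cases hx : ∀ r : ℚ, x ≠ r
  · exfalso
    obtain ⟨B, A, hAB⟩ := exists_eq_add_mul hK hx (-x ^ 2)
    have hAB : x ^ 2 + A * x + B = 0 := by linear_combination -hAB
    obtain ⟨n, m, rfl⟩ := exists_eq_add_mul hK hx y
    obtain ⟨n', m', rfl⟩ := exists_eq_add_mul hK hx z
    have hne : 1 + A + B ≠ 0 := fun h => by
      have hK : (1 : K) + A + B = 0 := by exact_mod_cast congrArg (Rat.cast : ℚ → K) h
      have : (x - 1) * (x + 1 + A) = 0 := by linear_combination hAB - hK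
      rcases mul_eq_zero.mp this with h' | h'
      · exact hx 1 (by push_cast; linear_combination h')
      · exact hx (-1 - A) (by push_cast; linear_combination h')
    have hne' : 1 - A + B ≠ 0 := fun h => by
      have hK : (1 : K) - A + B = 0 := by exact_mod_cast congrArg (Rat.cast : ℚ → K) h
      have : (x + 1) * (x - 1 + A) = 0 := by linear_combination hAB - hK
      rcases mul_eq_zero.mp this with h' | h'
      · exact hx (-1) (by push_cast; linear_combination h')
      · exact hx (1 - A) (by push_cast; linear_combination h')
    obtain ⟨M, hM⟩ := cubic_families hx hAB (by rw [add_comm]; exact hy)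
    obtain ⟨u, v, huv, h2⟩ := quartic_families hx hAB (by rw [add_comm]; exact hz) hne
    exact (families_disjoint huv hM h2).elim hne hne'
  · push Not at hx
    obtain ⟨r, rfl⟩ := hx
    suffices h : r ^ 2 = 1 by exact_mod_cast congrArg (Rat.cast : ℚ → K) h
    by_cases hyr : ∀ s : ℚ, y ≠ s
    · obtain ⟨a, b, rfl⟩ := exists_eq_add_mul hK hyr z
      -- `z = a + by` has a rational square, as `y` does, so one of `a`, `b` vanishes
      obtain ⟨e0, e1⟩ := eq_zero_of_add_mul_eq_zero hyr
        (a := a ^ 2 + b ^ 2 * (2 * (r ^ 3 + r ^ 2 - r + 1)) - (r ^ 2 + 1) * (3 - r ^ 2))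
        (b := 2 * a * b) (by push_cast; linear_combination hz - (b : K) ^ 2 * hy)
      rcases mul_eq_zero.mp e1 with h0 | rfl
      · obtain rfl : a = 0 := by linarith
        exact sq_eq_one_of_quartic_eq_sq_mul_cubic (b := b) (by linear_combination -e0)
      · exact sq_eq_one_of_quartic_eq_sq (z := a) (by linear_combination e0)
    · push Not at hyr
      obtain ⟨s, rfl⟩ := hyr
      have hy' : s ^ 2 = 2 * (r ^ 3 + r ^ 2 - r + 1) := by exact_mod_cast hy
      rcases eq_one_or_neg_one_of_sq_eq_cubic hy' with rfl | rfl <;> norm_num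

end QuadraticField

/-! ### From the graph to the curve -/

/-- The vertices `0, 1, 2, 4` and `6, 7, 8` of a copy of `G_1` give a point of the curve, with
`x = -γ / p` for the fixed point `p` and the preimage `γ` of `-p`. -/
theorem mainTheorem7 (K : Type*) [Field K] [NumberField K] (hK : Module.finrank ℚ K = 2) (c : K) :
    ¬ (preperiodicGraph c).ContainsCopyOf graphG1 := by
  rintro ⟨φ, hinj, hφ⟩
  have hne : ∀ i j, i ≠ j → (φ i : K) ≠ (φ j : K) := fun i j hij h =>
    hij (hinj (Subtype.ext h))
  have hstep : ∀ i, (φ i : K) ^ 2 + c = (φ (graphG1Next i) : K) := fun i => hφ i _ rfl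
  have sq_eq : ∀ {a b : K}, a ≠ b → a ^ 2 + c = b ^ 2 + c → b = -a := fun {a b} hab h => by
    have : (a - b) * (a + b) = 0 := by linear_combination h
    rcases mul_eq_zero.mp this with h' | h'
    · exact absurd (sub_eq_zero.mp h') hab
    · linear_combination h'
  have h0 : (φ 0 : K) ^ 2 + c = φ 0 := hstep 0
  have h1 : (φ 1 : K) ^ 2 + c = φ 0 := hstep 1
  have h2 : (φ 2 : K) ^ 2 + c = φ 1 := hstep 2
  have h4 : (φ 4 : K) ^ 2 + c = φ 2 := hstep 4
  have h6 : (φ 6 : K) ^ 2 + c = φ 6 := hstep 6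
  have h7 : (φ 7 : K) ^ 2 + c = φ 6 := hstep 7
  have h8 : (φ 8 : K) ^ 2 + c = φ 7 := hstep 8
  have hq : (φ 1 : K) = -φ 0 := sq_eq (hne 0 1 (by decide)) (h0.trans h1.symm)
  have hq' : (φ 7 : K) = -φ 6 := sq_eq (hne 6 7 (by decide)) (h6.trans h7.symm)
  have hpp : (φ 6 : K) = 1 - φ 0 := by
    have : ((φ 0 : K) - φ 6) * (φ 0 + φ 6 - 1) = 0 := by linear_combination h0 - h6
    rcases mul_eq_zero.mp this with h' | h'
    · exact absurd (sub_eq_zero.mp h') (hne 0 6 (by decide))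
    · linear_combination h'
  have hp0 : (φ 0 : K) ≠ 0 := fun h => hne 0 1 (by decide) (by rw [hq, h, neg_zero])
  generalize (φ 0 : K) = p at *
  generalize (φ 2 : K) = g at *
  generalize (φ 4 : K) = α at *
  generalize (φ 8 : K) = β at *
  rw [hq] at h2
  rw [hq', hpp] at h8
  obtain ⟨x, rfl⟩ : ∃ x, g = -(x * p) := ⟨-g / p, by field_simp⟩
  -- the slope `-x` parametrizes the conic `γ² = p² - 2p`
  have hpx : p * (1 - x ^ 2) = 2 := by
    apply mul_left_cancel₀ hp0
    linear_combination h0 - h2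
  have hx1 : x ^ 2 ≠ 1 := fun h => by
    rw [h, sub_self, mul_zero] at hpx
    exact two_ne_zero hpx.symm
  refine hx1 (sq_eq_one_of_quadratic_point hK (x := x) (y := α * (1 - x ^ 2))
    (z := β * (1 - x ^ 2)) ?_ ?_)
  · linear_combination (1 - x ^ 2) ^ 2 * (h4 - h0) +
      (p * (1 - x ^ 2) + 2 - (x + 1) * (1 - x ^ 2)) * hpx
  · linear_combination (1 - x ^ 2) ^ 2 * (h8 - h0) + (p * (1 - x ^ 2) + 2) * hpx
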